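/- For a nonempty finite set $X\subseteq\mathbb{R}^d$ and a nonempty finite set $C\subseteq\mathbb{R}^d$ of centers let $\varphi(x,C)=\min_{c\in C}\|x-c\|_2^2$ and $\varphi(X,C)=\sum_{x\in X}\varphi(x,C)$, and let $\mathrm{OPT}_k(X)=\inf_C\varphi(X,C)$, the infimum over all nonempty sets $C\subseteq\mathbb{R}^d$ of at most $k$ centers. Greedy $k$-means++ seeding with $\ell\ge 1$ candidates per step is the following random procedure. 1. Sample $c_1^1,\dots,c_1^\ell$ independently and uniformly from $X$, let $c_1$ be a candidate $c_1^j$ that minimizes $\varphi(X,\{c_1^j\})$, and put $C_1=\{c_1\}$. 2. For $i=1,\dots,k-1$: sample $c_{i+1}^1,\dots,c_{i+1}^\ell$ independently from $X$, each being equal to $x\in X$ with probability $\varphi(x,C_i)/\varphi(X,C_i)$ (uniformly from $X$ if $\varphi(X,C_i)=0$), let $c_{i+1}$ be a candidate $c_{i+1}^j$ that minimizes $\varphi(X,C_i\cup\{c_{i+1}^j\})$, and put $C_{i+1}=C_i\cup\{c_{i+1}\}$. 3. Return $C_k$. Ties in the minimizations are broken by an arbitrary fixed rule, which may depend on $C_i$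 and on the tuple of candidates. **Theorem.** Greedy $k$-means++ is an $O(\ell^3\log^3 k)$-approximation algorithm in expectation: there is an absolute constant $A>0$ such that for all $d\ge 0$, $k\ge 2$, $\ell\ge 1$, every nonempty finite set $X\subseteq\mathbb{R}^d$ and every tie-breaking rule, $$\mathbb{E}\big[\varphi(X,C_k)\big]\;\le\; A\,\ell^3(\log k)^3\cdot \mathrm{OPT}_k(X).$$ -/

import Mathlib

namespace GreedyKMeans

noncomputable section

/-- `φ(x, C) = min_{c ∈ C} ‖x - c‖²`, the cost of a point `x` with respect to a nonempty finite
set `C` of centers (the value for `C = ∅` is irrelevant). -/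
def pointCost {d : ℕ} (C : Finset (EuclideanSpace ℝ (Fin d))) (x : EuclideanSpace ℝ (Fin d)) : ℝ :=
  if h : C.Nonempty then C.inf' h (fun c => ‖x - c‖ ^ 2) else 0

/-- `φ(X, C) = ∑_{x ∈ X} φ(x, C)`. -/
def cost {d : ℕ} (X C : Finset (EuclideanSpace ℝ (Fin d))) : ℝ :=
  ∑ x ∈ X, pointCost C x

/-- The optimal `k`-means cost of `X`. Centers are arbitrary points of the space, and at most `k`
of them are used; since additional centers never increase the cost, this is the same as using
exactly `k` centers. -/
def optCost {d : ℕ} (X : Finset (EuclideanSpace ℝ (Fin d))) (k : ℕ) : ℝ :=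
  sInf ((fun C => cost X C) ''
    {C : Finset (EuclideanSpace ℝ (Fin d)) | C.Nonempty ∧ C.card ≤ k})

lemma pointCost_nonneg {d : ℕ} (C : Finset (EuclideanSpace ℝ (Fin d)))
    (x : EuclideanSpace ℝ (Fin d)) : 0 ≤ pointCost C x := by
  unfold pointCost
  split_ifs with h
  · exact Finset.le_inf' h _ (fun c _ => by positivity)
  · exact le_rfl

lemma cost_nonneg {d : ℕ} (X C : Finset (EuclideanSpace ℝ (Fin d))) : 0 ≤ cost X C :=
  Finset.sum_nonneg fun x _ => pointCost_nonneg C x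

/-- A set of data points, viewed as a set of points of the ambient space. -/
def points {d : ℕ} {X : Finset (EuclideanSpace ℝ (Fin d))} (C : Finset X) :
    Finset (EuclideanSpace ℝ (Fin d)) :=
  C.map (Function.Embedding.subtype _)

/-- The distribution on `X` giving `x` the probability `φ(x, C) / φ(X, C)`. If `φ(X, C) = 0`
these ratios are undefined (and every later solution has cost `0`); the uniform distribution is
used then. -/
def costDist {d : ℕ} (X : Finset (EuclideanSpace ℝ (Fin d))) [Nonempty X]
    (C : Finset (EuclideanSpace ℝ (Fin d))) : PMF X :=
  if h : cost X C = 0 then PMF.uniformOfFintype X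
  else PMF.ofFintype (fun x : X => ENNReal.ofReal (pointCost C x / cost X C)) (by
    rw [← ENNReal.ofReal_sum_of_nonneg (f := fun x : X => pointCost C x / cost X C)
      (fun x _ => div_nonneg (pointCost_nonneg C x) (cost_nonneg X C)), ← Finset.sum_div,
      Finset.sum_coe_sort X (fun x => pointCost C x)]
    change ENNReal.ofReal (cost X C / cost X C) = 1
    rw [div_self h, ENNReal.ofReal_one])

/-- The law of `ℓ` independent samples from `p`. -/
def iidSamples {α : Type*} [Fintype α] (ℓ : ℕ) (p : PMF α) : PMF (Fin ℓ → α) :=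
  PMF.ofFintype (fun c => ∏ j, p (c j)) (by
    classical
    have h : ∑ a, p a = 1 := by rw [← tsum_fintype (L := .unconditional _)]; exact p.tsum_coe
    rw [← Fintype.piFinset_univ, ← Finset.prod_univ_sum (fun _ => Finset.univ) (fun _ a => p a)]
    simp [h])

open scoped Classical in
/-- A rule `sel`, which chooses one of the candidates `c 0, …, c (ℓ - 1)` given the current set of
centers `C`, is greedy if the chosen candidate always minimizes the new cost
`φ(X, C ∪ {c j})`. Ties are broken arbitrarily. -/
def IsGreedy {d ℓ : ℕ} (X : Finset (EuclideanSpace ℝ (Fin d)))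
    (sel : Finset X → (Fin ℓ → X) → Fin ℓ) : Prop :=
  ∀ (C : Finset X) (c : Fin ℓ → X) (j : Fin ℓ),
    cost X (points (insert (c (sel C c)) C)) ≤ cost X (points (insert (c j) C))

open scoped Classical in
/-- One step from the centers `C`: draw `ℓ` independent candidates from `p` and add the candidate
chosen by `sel`. -/
def addCenter {d ℓ : ℕ} {X : Finset (EuclideanSpace ℝ (Fin d))}
    (sel : Finset X → (Fin ℓ → X) → Fin ℓ) (p : PMF X) (C : Finset X) : PMF (Finset X) :=
  (iidSamples ℓ p).map (fun c => insert (c (sel C c)) C)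

/-- The law of the set `C_i` of centers after `i` steps: the candidates of the first step are
uniform on `X`, those of every later step are sampled proportionally to their current cost. -/
def seeding {d ℓ : ℕ} (X : Finset (EuclideanSpace ℝ (Fin d))) [Nonempty X]
    (sel : Finset X → (Fin ℓ → X) → Fin ℓ) : ℕ → PMF (Finset X)
  | 0 => PMF.pure ∅
  | 1 => addCenter sel (PMF.uniformOfFintype X) ∅
  | i + 2 => (seeding X sel (i + 1)).bind fun C => addCenter sel (costDist X (points C)) C

/-- `E[φ(X, C_k)]`, a finite sum over all subsets of `X`. -/
def expectedCost {d ℓ : ℕ} (X : Finset (EuclideanSpace ℝ (Fin d))) [Nonempty X]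
    (sel : Finset X → (Fin ℓ → X) → Fin ℓ) (k : ℕ) : ℝ :=
  ∑ C : Finset X, (seeding X sel k C).toReal * cost X (points C)

end

end GreedyKMeans

namespace GreedyKMeans

noncomputable section

open scoped Classical

/-! Fix any set T of at most k centers and split X into its clusters K, with centers μ and costs o =
`centerCost K μ`. Two potentials are followed through one seeding step.

Covered clusters are cheap (`expect_covered_costOn_le`). A center sampled from K proportionally to
cost leaves K with expected cost at most 16 o (`sum_sqDist_mul_costOn_insert_le`), but the greedy
choice may favour bad points, and a union bound over the candidates only gives 16 ℓ o p for the step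
that covers K, p being the share of K in the total cost. So p, summed over the steps during which K
is active (uncovered and expensive), should be O(ℓ log² k) in expectation, which
`IsActive.expect_clusterPotential_le` provides. Either candidates outside K rarely compete with a
center near μ, and then the greedy choice lies in K with probability of order p; or they often do,
and then the total cost falls by the order of `centerGain`, which lowers the logarithm of total cost
over gain. That logarithm can rise again only when a new center lowers the scale at μ. Then
`nearCount` usually shrinks by a factor 1 - L/M, and it stays at least |K|/2 while K is active. The
exceptional `slowPoints` are sampled rarely enough if M is of order ℓ L², where L is about log k.

Uncovered clusters are controlled by `missPotential` (`expect_missPotential_le`). By Cauchy–Schwarz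
over the uncovered clusters, a step lowers the total cost by almost the average cost per uncovered
cluster, and a candidate is wasted on a covered cluster only in proportion to the covered cost. With
r + 1 steps left the increase is O(ℓ/(r+1)) times the covered plus optimal cost, and the harmonic
sum gives O(ℓ log k).

The three factors ℓ come from union bounds: over slow points, over hits of K, and over wasted
candidates. Two logarithms come from M, one from the harmonic sum. -/

/-- The expectation of `f` under a law on a finite type. -/
def expect {α : Type*} [Fintype α] (p : PMF α) (f : α → ℝ) : ℝ :=
  ∑ a, (p a).toReal * f a

/-! ### Expectations and independent candidates -/

section Expect

variable {α β : Type*} [Fintype α] [Fintype β]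

lemma sum_toReal_eq_one (p : PMF α) : ∑ a, (p a).toReal = 1 := by
  rw [← ENNReal.toReal_sum (fun a _ => p.apply_ne_top a), ← tsum_fintype (L := .unconditional _),
    p.tsum_coe, ENNReal.toReal_one]

lemma expect_const (p : PMF α) (b : ℝ) : expect p (fun _ => b) = b := by
  simp [expect, ← Finset.sum_mul, sum_toReal_eq_one]

lemma expect_mono_of_support {p : PMF α} {f g : α → ℝ} (h : ∀ a, p a ≠ 0 → f a ≤ g a) :
    expect p f ≤ expect p g := by
  refine Finset.sum_le_sum fun a _ => ?_
  by_cases ha : p a = 0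
  · simp [ha]
  · exact mul_le_mul_of_nonneg_left (h a ha) ENNReal.toReal_nonneg

lemma expect_mono {p : PMF α} {f g : α → ℝ} (h : ∀ a, f a ≤ g a) : expect p f ≤ expect p g :=
  expect_mono_of_support fun a _ => h a

lemma expect_nonneg {p : PMF α} {f : α → ℝ} (h : ∀ a, 0 ≤ f a) : 0 ≤ expect p f :=
  Finset.sum_nonneg fun a _ => mul_nonneg ENNReal.toReal_nonneg (h a)

lemma expect_add (p : PMF α) (f g : α → ℝ) :
    expect p (fun a => f a + g a) = expect p f + expect p g := by
  simp [expect, mul_add, Finset.sum_add_distrib]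

lemma expect_sub (p : PMF α) (f g : α → ℝ) :
    expect p (fun a => f a - g a) = expect p f - expect p g := by
  simp [expect, mul_sub, Finset.sum_sub_distrib]

lemma expect_const_mul (p : PMF α) (b : ℝ) (f : α → ℝ) :
    expect p (fun a => b * f a) = b * expect p f := by
  simp only [expect, Finset.mul_sum]
  exact Finset.sum_congr rfl fun a _ => by ring

lemma expect_sum {ι : Type*} (s : Finset ι) (p : PMF α) (f : ι → α → ℝ) :
    expect p (fun a => ∑ i ∈ s, f i a) = ∑ i ∈ s, expect p (f i) := by
  simp only [expect, Finset.mul_sum]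
  exact Finset.sum_comm

lemma expect_bind (p : PMF α) (q : α → PMF β) (f : β → ℝ) :
    expect (p.bind q) f = expect p (fun a => expect (q a) f) := by
  have h (b : β) : ((p.bind q) b).toReal = ∑ a, (p a).toReal * (q a b).toReal := by
    rw [PMF.bind_apply, tsum_fintype, ENNReal.toReal_sum
      (fun a _ => ENNReal.mul_ne_top (p.apply_ne_top a) ((q a).apply_ne_top b))]
    simp
  simp only [expect, h, Finset.sum_mul, Finset.mul_sum]
  rw [Finset.sum_comm]
  exact Finset.sum_congr rfl fun a _ => Finset.sum_congr rfl fun b _ => by ring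

lemma expect_pure (a : α) (f : α → ℝ) : expect (PMF.pure a) f = f a := by
  unfold expect
  rw [Finset.sum_eq_single a]
  · simp
  · intro b _ hb
    simp [PMF.pure_apply, hb]
  · simp

lemma expect_map (p : PMF α) (g : α → β) (f : β → ℝ) :
    expect (p.map g) f = expect p (fun a => f (g a)) := by
  rw [← PMF.bind_pure_comp, expect_bind]
  simp [expect_pure]

lemma expect_iidSamples_prod {ℓ : ℕ} (p : PMF α) (f : Fin ℓ → α → ℝ) :
    expect (iidSamples ℓ p) (fun c => ∏ j, f j (c j)) = ∏ j, expect p (f j) := by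
  have h (c : Fin ℓ → α) : (iidSamples ℓ p c).toReal = ∏ j, (p (c j)).toReal := by
    simp [iidSamples, PMF.ofFintype_apply, ENNReal.toReal_prod]
  simp only [expect, h, ← Finset.prod_mul_distrib]
  rw [Finset.prod_univ_sum, Fintype.piFinset_univ]

lemma expect_iidSamples_apply {ℓ : ℕ} (p : PMF α) (f : α → ℝ) (i : Fin ℓ) :
    expect (iidSamples ℓ p) (fun c => f (c i)) = expect p f := by
  have h := expect_iidSamples_prod p (fun j : Fin ℓ => if j = i then f else fun _ => 1)
  have h1 (c : Fin ℓ → α) : (∏ j, (if j = i then f else fun _ => 1) (c j)) = f (c i) := by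
    rw [Finset.prod_eq_single i]
    · simp
    · intro j _ hj
      simp [hj]
    · simp
  rw [Finset.prod_eq_single i] at h
  · simpa [h1] using h
  · intro j _ hj
    simp [hj, expect_const]
  · simp

/-- A union bound for one selected sample out of `ℓ`. -/
lemma expect_iidSamples_sel_le {ℓ : ℕ} (p : PMF α) {f : α → ℝ} (hf : ∀ a, 0 ≤ f a)
    (s : (Fin ℓ → α) → Fin ℓ) :
    expect (iidSamples ℓ p) (fun c => f (c (s c))) ≤ ℓ * expect p f := by
  calc expect (iidSamples ℓ p) (fun c => f (c (s c)))
      ≤ expect (iidSamples ℓ p) (fun c => ∑ j, f (c j)) :=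
        expect_mono fun c => Finset.single_le_sum (f := fun j => f (c j)) (fun j _ => hf _)
          (Finset.mem_univ _)
    _ = ℓ * expect p f := by
        rw [expect_sum]
        simp [expect_iidSamples_apply]

lemma expect_indicator_compl (p : PMF α) (Q : α → Prop) [DecidablePred Q] :
    expect p (fun a => if Q a then 0 else 1) = 1 - expect p (fun a => if Q a then 1 else 0) := by
  have h := expect_sub p (fun _ => 1) (fun a => if Q a then 1 else 0)
  rw [expect_const] at h
  rw [← h]
  congr 1
  ext a
  split_ifs <;> simp

/-- If `Q` has probability at least `1 / (2 ℓ)`, one of `ℓ` samples satisfies it with probability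
at least `1 / 3`. -/
lemma third_le_expect_exists {ℓ : ℕ} (hℓ : 1 ≤ ℓ) (p : PMF α) (Q : α → Prop)
    [DecidablePred Q] (hQ : 1 / (2 * ℓ : ℝ) ≤ expect p (fun a => if Q a then 1 else 0)) :
    1 / 3 ≤ expect (iidSamples ℓ p) (fun c => if ∃ j, Q (c j) then 1 else 0) := by
  have h := expect_iidSamples_prod p (fun (_ : Fin ℓ) a => if Q a then (0 : ℝ) else 1)
  have h1 (c : Fin ℓ → α) : (∏ j, if Q (c j) then (0 : ℝ) else 1) =
      if ∃ j, Q (c j) then 0 else 1 := by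
    split_ifs with hc
    · obtain ⟨j, hj⟩ := hc
      exact Finset.prod_eq_zero (Finset.mem_univ j) (by simp [hj])
    · push Not at hc
      exact Finset.prod_eq_one fun j _ => by simp [hc j]
  simp only [h1, expect_indicator_compl, Finset.prod_const, Finset.card_univ, Fintype.card_fin]
    at h
  set q := expect p (fun a => if Q a then 1 else 0) with hq
  have hq1 : q ≤ 1 := by
    rw [← expect_const p 1]
    exact expect_mono fun a => by split_ifs <;> norm_num
  have hℓ' : (1 : ℝ) ≤ ℓ := by exact_mod_cast hℓ
  have hq0 : 0 ≤ q := le_trans (by positivity) hQ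
  have hlq : 1 / 2 ≤ ℓ * q := by
    calc (1 / 2 : ℝ) = ℓ * (1 / (2 * ℓ)) := by field_simp
      _ ≤ _ := by gcongr
  -- Since 1 + ℓ q ≥ 3/2, this bounds the failure probability by 2/3.
  have h2 : (1 - q) ^ ℓ * (1 + ℓ * q) ≤ 1 := by
    calc (1 - q) ^ ℓ * (1 + ℓ * q) ≤ (1 - q) ^ ℓ * (1 + q) ^ ℓ :=
          mul_le_mul_of_nonneg_left (one_add_mul_le_pow (by linarith) ℓ)
            (pow_nonneg (by linarith) _)
      _ = (1 - q ^ 2) ^ ℓ := by rw [← mul_pow]; ring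
      _ ≤ 1 := pow_le_one₀ (by nlinarith) (by nlinarith)
  have h3 : 0 ≤ (1 - q) ^ ℓ := pow_nonneg (by linarith) _
  nlinarith

/-- If `Q` has probability at most `1 / (2 ℓ)`, then with probability at least `P(g) / 2` one of
the samples satisfies `g` and no sample satisfies `Q`. -/
lemma half_mul_le_expect_exists_and {ℓ : ℕ} (hℓ : 1 ≤ ℓ) (p : PMF α) (g Q : α → Prop)
    [DecidablePred g] [DecidablePred Q] (hgQ : ∀ a, g a → ¬ Q a)
    (hQ : expect p (fun a => if Q a then 1 else 0) ≤ 1 / (2 * ℓ : ℝ)) :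
    expect p (fun a => if g a then 1 else 0) / 2 ≤
      expect (iidSamples ℓ p) (fun c => if (∃ j, g (c j)) ∧ ∀ j, ¬ Q (c j) then 1 else 0) := by
  -- It suffices that candidate 0 satisfies `g` and the other ℓ - 1 avoid `Q`. These events are
  -- independent, and Bernoulli's inequality gives (1 - q)^(ℓ-1) ≥ 1/2.
  set i : Fin ℓ := ⟨0, hℓ⟩
  have h := expect_iidSamples_prod p (fun (j : Fin ℓ) a =>
    if j = i then (if g a then (1 : ℝ) else 0) else (if Q a then (0 : ℝ) else 1))
  have h1 (c : Fin ℓ → α) : (∏ j, if j = i then (if g (c j) then (1 : ℝ) else 0)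
      else (if Q (c j) then (0 : ℝ) else 1)) ≤
      if (∃ j, g (c j)) ∧ ∀ j, ¬ Q (c j) then 1 else 0 := by
    split_ifs with hc
    · exact Finset.prod_le_one (fun j _ => by split_ifs <;> norm_num)
        (fun j _ => by split_ifs <;> norm_num)
    · refine le_of_eq ?_
      by_cases hg : g (c i)
      · have : ∃ j, Q (c j) := by
          by_contra! hne
          exact hc ⟨⟨i, hg⟩, hne⟩
        obtain ⟨j, hj⟩ := this
        have hji : j ≠ i := by
          rintro rfl
          exact hgQ _ hg hj
        exact Finset.prod_eq_zero (Finset.mem_univ j) (by simp [hj, hji])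
      · exact Finset.prod_eq_zero (Finset.mem_univ i) (by simp [hg])
  refine le_trans ?_ (expect_mono h1)
  rw [h, ← Finset.mul_prod_erase _ _ (Finset.mem_univ i)]
  have h2 : ∏ j ∈ Finset.univ.erase i, expect p (fun a =>
      if j = i then (if g a then (1 : ℝ) else 0) else (if Q a then (0 : ℝ) else 1)) =
      (1 - expect p (fun a => if Q a then 1 else 0)) ^ (ℓ - 1) := by
    rw [Finset.prod_congr rfl (g := fun _ => 1 - expect p (fun a => if Q a then 1 else 0))]
    · simp
    · intro j hj
      simp [Finset.ne_of_mem_erase hj, expect_indicator_compl]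
  rw [h2]
  set q := expect p (fun a => if Q a then 1 else 0) with hq
  have hℓ' : (1 : ℝ) ≤ ℓ := by exact_mod_cast hℓ
  have hq0 : 0 ≤ q := expect_nonneg fun a => by split_ifs <;> norm_num
  have hlq : ℓ * q ≤ 1 / 2 := by
    calc ℓ * q ≤ ℓ * (1 / (2 * ℓ)) := by gcongr
      _ = _ := by field_simp
  have h3 := one_add_mul_le_pow (a := -q) (by nlinarith) (ℓ - 1)
  rw [← sub_eq_add_neg, Nat.cast_sub hℓ, Nat.cast_one] at h3
  have h4 : 0 ≤ expect p (fun a => if g a then (1 : ℝ) else 0) :=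
    expect_nonneg fun a => by split_ifs <;> norm_num
  have h5 : 1 / 2 ≤ (1 - q) ^ (ℓ - 1) := by nlinarith
  simp only [if_true]
  nlinarith

end Expect

/-! ### Squared distances and sampling within one cluster -/

section Cost

variable {d : ℕ} {X : Finset (EuclideanSpace ℝ (Fin d))}

/-- The squared distance of `x` to the nearest center of `C`. -/
def sqDist (C : Finset X) (x : EuclideanSpace ℝ (Fin d)) : ℝ :=
  pointCost (points C) x

/-- The cost of the part `K` of the data with respect to the centers `C`. -/
def costOn (K C : Finset X) : ℝ :=
  ∑ x ∈ K, sqDist C x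

/-- The cost of the part `K` of the data with respect to the single center `μ`. -/
def centerCost (K : Finset X) (μ : EuclideanSpace ℝ (Fin d)) : ℝ :=
  ∑ x ∈ K, ‖(x : EuclideanSpace ℝ (Fin d)) - μ‖ ^ 2

lemma cost_points (C : Finset X) : cost X (points C) = costOn Finset.univ C :=
  (Finset.sum_coe_sort X fun x => pointCost (points C) x).symm

lemma sqDist_nonneg (C : Finset X) (x : EuclideanSpace ℝ (Fin d)) : 0 ≤ sqDist C x :=
  pointCost_nonneg _ _

lemma costOn_nonneg (K C : Finset X) : 0 ≤ costOn K C :=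
  Finset.sum_nonneg fun _ _ => sqDist_nonneg _ _

lemma centerCost_nonneg (K : Finset X) (μ : EuclideanSpace ℝ (Fin d)) : 0 ≤ centerCost K μ :=
  Finset.sum_nonneg fun _ _ => by positivity

lemma costOn_le_univ (K C : Finset X) : costOn K C ≤ costOn Finset.univ C :=
  Finset.sum_le_sum_of_subset_of_nonneg (Finset.subset_univ _) fun _ _ _ => sqDist_nonneg _ _

lemma sqDist_le {C : Finset X} {c : X} (hc : c ∈ C) (x : EuclideanSpace ℝ (Fin d)) :
    sqDist C x ≤ ‖x - c‖ ^ 2 := by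
  have hc' : (c : EuclideanSpace ℝ (Fin d)) ∈ points C := by
    simpa [points] using hc
  rw [sqDist, pointCost, dif_pos ⟨_, hc'⟩]
  exact Finset.inf'_le _ hc'

lemma exists_sqDist_eq {C : Finset X} (hC : C.Nonempty) (x : EuclideanSpace ℝ (Fin d)) :
    ∃ c ∈ C, sqDist C x = ‖x - c‖ ^ 2 := by
  have hC' : (points C).Nonempty := by simpa [points] using hC
  obtain ⟨c, hc, h⟩ := Finset.exists_mem_eq_inf' hC' (fun c => ‖x - c‖ ^ 2)
  obtain ⟨a, ha, rfl⟩ := Finset.mem_map.1 hc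
  exact ⟨a, ha, by rw [sqDist, pointCost, dif_pos hC', h]; rfl⟩

lemma sqDist_mono {C C' : Finset X} (hC : C.Nonempty) (h : C ⊆ C')
    (x : EuclideanSpace ℝ (Fin d)) : sqDist C' x ≤ sqDist C x := by
  obtain ⟨c, hc, hx⟩ := exists_sqDist_eq hC x
  exact hx ▸ sqDist_le (h hc) x

lemma sqDist_insert_le {C : Finset X} (hC : C.Nonempty) (c : X)
    (x : EuclideanSpace ℝ (Fin d)) : sqDist (insert c C) x ≤ sqDist C x :=
  sqDist_mono hC (Finset.subset_insert _ _) x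

lemma sqDist_insert_eq_or {C : Finset X} (hC : C.Nonempty) (c : X)
    (x : EuclideanSpace ℝ (Fin d)) :
    sqDist (insert c C) x = sqDist C x ∨ sqDist (insert c C) x = ‖x - c‖ ^ 2 := by
  obtain ⟨a, ha, hx⟩ := exists_sqDist_eq (Finset.insert_nonempty c C) x
  rcases Finset.mem_insert.1 ha with rfl | ha
  · exact Or.inr hx
  · exact Or.inl (le_antisymm (sqDist_insert_le hC c x) (hx ▸ sqDist_le ha x))

lemma costOn_mono {C C' : Finset X} (hC : C.Nonempty) (h : C ⊆ C') (K : Finset X) :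
    costOn K C' ≤ costOn K C :=
  Finset.sum_le_sum fun _ _ => sqDist_mono hC h _

lemma costOn_insert_le {C : Finset X} (hC : C.Nonempty) (c : X) (K : Finset X) :
    costOn K (insert c C) ≤ costOn K C :=
  costOn_mono hC (Finset.subset_insert _ _) K

lemma sqDist_le_add_sq {C : Finset X} (hC : C.Nonempty) (x y : EuclideanSpace ℝ (Fin d)) :
    sqDist C x ≤ (‖x - y‖ + √(sqDist C y)) ^ 2 := by
  obtain ⟨c, hc, hy⟩ := exists_sqDist_eq hC y
  rw [hy, Real.sqrt_sq (norm_nonneg _)]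
  refine (sqDist_le hc x).trans ?_
  gcongr
  exact norm_sub_le_norm_sub_add_norm_sub x y c

lemma sqDist_le_two_mul {C : Finset X} (hC : C.Nonempty) (x y : EuclideanSpace ℝ (Fin d)) :
    sqDist C x ≤ 2 * ‖x - y‖ ^ 2 + 2 * sqDist C y := by
  have h := sqDist_le_add_sq hC x y
  have h1 := Real.sq_sqrt (sqDist_nonneg C y)
  nlinarith [sq_nonneg (‖x - y‖ - √(sqDist C y))]

lemma costOn_le_two_mul {C : Finset X} (hC : C.Nonempty) (K : Finset X)
    (μ : EuclideanSpace ℝ (Fin d)) :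
    costOn K C ≤ 2 * centerCost K μ + 2 * (K.card * sqDist C μ) := by
  calc costOn K C ≤ ∑ x ∈ K, (2 * ‖(x : EuclideanSpace ℝ (Fin d)) - μ‖ ^ 2 + 2 * sqDist C μ) :=
        Finset.sum_le_sum fun x _ => sqDist_le_two_mul hC x μ
    _ = _ := by
        rw [Finset.sum_add_distrib, ← Finset.mul_sum, centerCost, Finset.sum_const, nsmul_eq_mul]
        ring

lemma norm_sub_sq_le (x y μ : EuclideanSpace ℝ (Fin d)) :
    ‖x - y‖ ^ 2 ≤ 2 * ‖x - μ‖ ^ 2 + 2 * ‖y - μ‖ ^ 2 := by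
  have h := norm_sub_le_norm_sub_add_norm_sub x μ y
  rw [norm_sub_rev μ y] at h
  nlinarith [sq_nonneg (‖x - μ‖ - ‖y - μ‖), norm_nonneg (x - y), norm_nonneg (x - μ),
    norm_nonneg (y - μ)]

lemma sum_centerCost_le (K : Finset X) (μ : EuclideanSpace ℝ (Fin d)) :
    ∑ c ∈ K, centerCost K c ≤ 4 * K.card * centerCost K μ := by
  calc ∑ c ∈ K, centerCost K c
      ≤ ∑ c ∈ K, ∑ x ∈ K, (2 * ‖(x : EuclideanSpace ℝ (Fin d)) - μ‖ ^ 2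
          + 2 * ‖(c : EuclideanSpace ℝ (Fin d)) - μ‖ ^ 2) :=
        Finset.sum_le_sum fun c _ => Finset.sum_le_sum fun x _ => norm_sub_sq_le _ _ _
    _ = _ := by
        simp only [Finset.sum_add_distrib, ← Finset.mul_sum, Finset.sum_const, nsmul_eq_mul,
          centerCost]
        ring

/-- Sampling a center from `K` proportionally to the cost reduces the cost of `K` to a multiple
of its optimal cost. -/
lemma sum_sqDist_mul_costOn_insert_le {C : Finset X} (hC : C.Nonempty) (K : Finset X)
    (μ : EuclideanSpace ℝ (Fin d)) :
    ∑ c ∈ K, sqDist C c * costOn K (insert c C) ≤ 16 * centerCost K μ * costOn K C := by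
  rcases K.eq_empty_or_nonempty with rfl | hK
  · simp [costOn]
  have hn : (0 : ℝ) < K.card := by exact_mod_cast hK.card_pos
  -- The triangle inequality averaged over K: the weight of c exceeds the mean weight by much only
  -- if c is a costly center for K. In `h3` the new cost is bounded by `costOn K C` in the first
  -- term and by `centerCost K c` in the second.
  have h1 (c : X) : K.card * sqDist C c ≤ 2 * centerCost K c + 2 * costOn K C := by
    calc K.card * sqDist C c = ∑ x ∈ K, sqDist C c := by simp
      _ ≤ ∑ x ∈ K, (2 * ‖(x : EuclideanSpace ℝ (Fin d)) - c‖ ^ 2 + 2 * sqDist C x) :=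
          Finset.sum_le_sum fun x _ => by
            rw [norm_sub_rev]
            exact sqDist_le_two_mul hC c x
      _ = _ := by
          simp [Finset.sum_add_distrib, ← Finset.mul_sum, centerCost, costOn]
  have h2 (c : X) : costOn K (insert c C) ≤ centerCost K c :=
    Finset.sum_le_sum fun x _ => sqDist_le (Finset.mem_insert_self _ _) _
  have h3 (c : X) : K.card * (sqDist C c * costOn K (insert c C)) ≤
      4 * costOn K C * centerCost K c := by
    have h4 := costOn_nonneg K (insert c C)
    have h5 := costOn_insert_le hC c K
    have h6 := centerCost_nonneg K (c : EuclideanSpace ℝ (Fin d))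
    have h7 := costOn_nonneg K C
    calc K.card * (sqDist C c * costOn K (insert c C))
        = (K.card * sqDist C c) * costOn K (insert c C) := by ring
      _ ≤ (2 * centerCost K c + 2 * costOn K C) * costOn K (insert c C) := by
          gcongr
          exact h1 c
      _ = 2 * (centerCost K c * costOn K (insert c C)) +
            2 * (costOn K C * costOn K (insert c C)) := by ring
      _ ≤ 2 * (centerCost K c * costOn K C) + 2 * (costOn K C * centerCost K c) := by
          gcongr
          exact h2 c
      _ = _ := by ring
  have h4 : K.card * ∑ c ∈ K, sqDist C c * costOn K (insert c C) ≤
      K.card * (16 * centerCost K μ * costOn K C) := by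
    calc K.card * ∑ c ∈ K, sqDist C c * costOn K (insert c C)
        = ∑ c ∈ K, K.card * (sqDist C c * costOn K (insert c C)) := Finset.mul_sum _ _ _
      _ ≤ ∑ c ∈ K, 4 * costOn K C * centerCost K c := Finset.sum_le_sum fun c _ => h3 c
      _ = 4 * costOn K C * ∑ c ∈ K, centerCost K c := (Finset.mul_sum _ _ _).symm
      _ ≤ 4 * costOn K C * (4 * K.card * centerCost K μ) :=
          mul_le_mul_of_nonneg_left (sum_centerCost_le K μ)
            (mul_nonneg (by norm_num) (costOn_nonneg K C))
      _ = _ := by ring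
  exact le_of_mul_le_mul_left h4 hn

lemma expect_costDist [Nonempty X] {C : Finset X} (h : costOn Finset.univ C ≠ 0) (f : X → ℝ) :
    expect (costDist X (points C)) f = (∑ c : X, sqDist C c * f c) / costOn Finset.univ C := by
  have h' : ¬ cost X (points C) = 0 := by rwa [cost_points]
  unfold expect costDist
  rw [dif_neg h', Finset.sum_div]
  refine Finset.sum_congr rfl fun c _ => ?_
  rw [PMF.ofFintype_apply, ENNReal.toReal_ofReal (div_nonneg (pointCost_nonneg _ _)
    (cost_nonneg _ _)), cost_points, sqDist]
  ring

lemma expect_costDist_indicator [Nonempty X] {C : Finset X} (h : costOn Finset.univ C ≠ 0)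
    (K : Finset X) :
    expect (costDist X (points C)) (fun c => if c ∈ K then 1 else 0) =
      costOn K C / costOn Finset.univ C := by
  rw [expect_costDist h]
  simp only [mul_ite, mul_one, mul_zero, Finset.sum_ite_mem, Finset.univ_inter]
  rfl

lemma expect_addCenter {ℓ : ℕ} (sel : Finset X → (Fin ℓ → X) → Fin ℓ) (p : PMF X) (C : Finset X)
    (f : Finset X → ℝ) :
    expect (addCenter sel p C) f =
      expect (iidSamples ℓ p) (fun c => f (insert (c (sel C c)) C)) :=
  expect_map _ _ _

lemma IsGreedy.costOn_le {ℓ : ℕ} {sel : Finset X → (Fin ℓ → X) → Fin ℓ} (h : IsGreedy X sel)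
    (C : Finset X) (c : Fin ℓ → X) (j : Fin ℓ) :
    costOn Finset.univ (insert (c (sel C c)) C) ≤ costOn Finset.univ (insert (c j) C) := by
  simpa only [cost_points] using h C c j

end Cost

/-! ### Geometry around the center of an active cluster -/

section ClusterPotential

variable {d : ℕ} {X : Finset (EuclideanSpace ℝ (Fin d))}

/-- The squared distance of `μ` to the nearest center, rounded down to a power of `16`, is
`16 ^ scale C μ`. -/
def scale (C : Finset X) (μ : EuclideanSpace ℝ (Fin d)) : ℤ :=
  Int.log 16 (sqDist C μ)

/-- The data points at distance less than `4 ^ m` from `μ`. -/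
def ballPoints (X : Finset (EuclideanSpace ℝ (Fin d))) (μ : EuclideanSpace ℝ (Fin d)) (m : ℤ) :
    Finset X :=
  Finset.univ.filter fun x : X => ‖(x : EuclideanSpace ℝ (Fin d)) - μ‖ < 4 ^ m

/-- The data points strictly closer to `μ` than `c`. -/
def closerPoints (μ : EuclideanSpace ℝ (Fin d)) (c : X) : Finset X :=
  Finset.univ.filter fun x : X =>
    ‖(x : EuclideanSpace ℝ (Fin d)) - μ‖ < ‖(c : EuclideanSpace ℝ (Fin d)) - μ‖

/-- The number of data points near `μ`, in comparison with the nearest center. -/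
def nearCount (C : Finset X) (μ : EuclideanSpace ℝ (Fin d)) : ℝ :=
  min ((ballPoints X μ (scale C μ)).card : ℝ) (2 * (ballPoints X μ (scale C μ - 1)).card)

/-- Up to constants, the decrease of the cost if a center were placed at `μ`. -/
def centerGain (C : Finset X) (μ : EuclideanSpace ℝ (Fin d)) : ℝ :=
  nearCount C μ * (4 ^ scale C μ) ^ 2

/-- A part `K` of the data is active if it contains no center and its cost is much larger than
its cost with respect to `μ`. -/
def IsActive (K : Finset X) (μ : EuclideanSpace ℝ (Fin d)) (C : Finset X) : Prop :=
  Disjoint C K ∧ 2048 * centerCost K μ < costOn K C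

/-- The truncated logarithm of the ratio between the total cost and the gain at `μ`. -/
def logRatio (L : ℝ) (μ : EuclideanSpace ℝ (Fin d)) (C : Finset X) : ℝ :=
  min L (4 + Real.log (costOn Finset.univ C / centerGain C μ))

/-- A potential which decreases, in expectation, as long as `K` is active. -/
def clusterPotential (L M : ℝ) (K : Finset X) (μ : EuclideanSpace ℝ (Fin d)) (C : Finset X) : ℝ :=
  if IsActive K μ C then -(K.card / nearCount C μ * (M - logRatio L μ C)) else -(4 * M)

/-- The points of the ball around `μ` which, chosen as a center, reduce the scale at `μ`, but the
number of near points by less than the factor `1 - δ`. -/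
def slowPoints (δ : ℝ) (μ : EuclideanSpace ℝ (Fin d)) (C : Finset X) : Finset X :=
  (ballPoints X μ (scale C μ)).filter fun c =>
    (1 - δ) * nearCount C μ <
      min ((ballPoints X μ (scale C μ - 1)).card : ℝ) (closerPoints μ c).card

variable {K C : Finset X} {μ : EuclideanSpace ℝ (Fin d)}

lemma ballPoints_mono {m m' : ℤ} (h : m ≤ m') : ballPoints X μ m ⊆ ballPoints X μ m' := by
  intro x hx
  simp only [ballPoints, Finset.mem_filter, Finset.mem_univ, true_and] at hx ⊢
  exact hx.trans_le (zpow_le_zpow_right₀ (by norm_num) h)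

lemma nearCount_le_ballPoints (C : Finset X) (μ : EuclideanSpace ℝ (Fin d)) :
    nearCount C μ ≤ (ballPoints X μ (scale C μ)).card :=
  min_le_left _ _

lemma nearCount_le_two_mul (C : Finset X) (μ : EuclideanSpace ℝ (Fin d)) :
    nearCount C μ ≤ 2 * (ballPoints X μ (scale C μ - 1)).card :=
  min_le_right _ _

lemma ballPoints_pred_le_nearCount (C : Finset X) (μ : EuclideanSpace ℝ (Fin d)) :
    ((ballPoints X μ (scale C μ - 1)).card : ℝ) ≤ nearCount C μ := by
  refine le_min ?_ ?_
  · exact_mod_cast Finset.card_le_card (ballPoints_mono (by omega))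
  · have : (0 : ℝ) ≤ (ballPoints X μ (scale C μ - 1)).card := by positivity
    linarith

/-- Sorting a finite set by a function, at most `n - t` elements have at least `t`
predecessors. -/
lemma card_filter_rank_le {α : Type*} [Fintype α] (f : α → ℝ) (S : Finset α)
    (hS : ∀ a ∈ S, ∀ b, f b < f a → b ∈ S) (t : ℝ) (ht : t ≤ S.card) :
    ((S.filter fun a => t < (Finset.univ.filter fun b => f b < f a).card).card : ℝ) ≤
      S.card - t := by
  set T := S.filter fun a => t < (Finset.univ.filter fun b => f b < f a).card with hT
  rcases T.eq_empty_or_nonempty with h | h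
  · rw [h]
    simpa using ht
  · obtain ⟨a, haT, ha⟩ := T.exists_min_image f h
    have haT' := (Finset.mem_filter.1 haT)
    have hdisj : Disjoint T (Finset.univ.filter fun b => f b < f a) := by
      rw [Finset.disjoint_left]
      intro b hb hb'
      exact absurd (ha b hb) (not_le.2 (Finset.mem_filter.1 hb').2)
    have hsub : T ∪ (Finset.univ.filter fun b => f b < f a) ⊆ S := by
      refine Finset.union_subset (Finset.filter_subset _ _) fun b hb => ?_
      exact hS a haT'.1 b (Finset.mem_filter.1 hb).2
    have hcard := Finset.card_le_card hsub
    rw [Finset.card_union_of_disjoint hdisj] at hcard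
    have hcard' : (T.card : ℝ) + (Finset.univ.filter fun b => f b < f a).card ≤ S.card := by
      exact_mod_cast hcard
    linarith [haT'.2]

/-- Both branches of the minimum in `nearCount` matter. If it is the size of the large ball, slow
points are those of rank above (1 - δ) times that size. If it is twice the size of the small ball,
any drop of the scale halves it, so no point is slow. -/
lemma card_slowPoints_le {δ : ℝ} (hδ : 0 ≤ δ) (hδ' : δ ≤ 1 / 2) (C : Finset X)
    (μ : EuclideanSpace ℝ (Fin d)) :
    ((slowPoints δ μ C).card : ℝ) ≤ δ * nearCount C μ := by
  have h0 : 0 ≤ nearCount C μ := le_trans (by positivity) (ballPoints_pred_le_nearCount C μ)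
  by_cases h : nearCount C μ = (ballPoints X μ (scale C μ)).card
  · have h1 := card_filter_rank_le
      (fun x : X => ‖(x : EuclideanSpace ℝ (Fin d)) - μ‖) (ballPoints X μ (scale C μ))
      (fun a ha b hb => by
        simp only [ballPoints, Finset.mem_filter, Finset.mem_univ, true_and] at ha ⊢
        exact hb.trans ha) ((1 - δ) * nearCount C μ) (by rw [← h]; nlinarith)
    rw [← h] at h1
    have h2 : slowPoints δ μ C ⊆ (ballPoints X μ (scale C μ)).filter fun a =>
        (1 - δ) * nearCount C μ < (Finset.univ.filter fun b : X =>
          ‖(b : EuclideanSpace ℝ (Fin d)) - μ‖ < ‖(a : EuclideanSpace ℝ (Fin d)) - μ‖).card := by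
      refine Finset.monotone_filter_right _ fun c _ hc => ?_
      exact hc.trans_le (min_le_right _ _)
    have h3 : ((slowPoints δ μ C).card : ℝ) ≤ _ := Nat.cast_le.2 (Finset.card_le_card h2)
    linarith
  · have h1 : nearCount C μ = 2 * (ballPoints X μ (scale C μ - 1)).card :=
      (min_choice _ _).resolve_left h
    have h2 : slowPoints δ μ C = ∅ := by
      refine Finset.filter_eq_empty_iff.2 fun c _ hc => ?_
      have := hc.trans_le (min_le_left _ _)
      nlinarith
    rw [h2]
    simpa using mul_nonneg hδ h0

namespace IsActive

/-- Activity makes the term 2 `centerCost K μ` of the triangle inequality negligible, so |K| times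
the squared distance from μ to C carries the cost of K. -/
lemma sqDist_pos_and (h : IsActive K μ C) (hC : C.Nonempty) :
    costOn K C ≤ 4 * (K.card * sqDist C μ) ∧ 512 * centerCost K μ < K.card * sqDist C μ ∧
      0 < sqDist C μ := by
  have h1 := costOn_le_two_mul hC K μ
  have h2 := h.2
  have h3 := centerCost_nonneg K μ
  have h4 : 0 < K.card * sqDist C μ := by linarith
  exact ⟨by linarith, by linarith, (pos_iff_pos_of_mul_pos h4).1
    (lt_of_le_of_ne (by positivity) (left_ne_zero_of_mul h4.ne').symm)⟩

lemma sqrt_bounds (h : IsActive K μ C) (hC : C.Nonempty) :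
    (4 : ℝ) ^ scale C μ ≤ √(sqDist C μ) ∧ √(sqDist C μ) < 4 * 4 ^ scale C μ := by
  have hD := (h.sqDist_pos_and hC).2.2
  have h16 (m : ℤ) : (16 : ℝ) ^ m = (4 ^ m) ^ 2 := by
    rw [show (16 : ℝ) = 4 * 4 by norm_num, mul_zpow, sq]
  have h1 := Int.zpow_log_le_self (b := 16) (by norm_num) hD
  have h2 := Int.lt_zpow_succ_log_self (b := 16) (by norm_num) (sqDist C μ)
  rw [Nat.cast_ofNat, h16] at h1 h2
  rw [zpow_add_one₀ (by norm_num)] at h2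
  refine ⟨Real.le_sqrt_of_sq_le h1, ?_⟩
  rw [Real.sqrt_lt' (by positivity)]
  rw [mul_comm] at h2
  exact h2

lemma sqDist_lt (h : IsActive K μ C) (hC : C.Nonempty) :
    sqDist C μ < 16 * (4 ^ scale C μ) ^ 2 := by
  have h1 := (h.sqrt_bounds hC).2
  have h2 := Real.sq_sqrt (sqDist_nonneg C μ)
  have h3 := Real.sqrt_nonneg (sqDist C μ)
  nlinarith

/-- Markov's inequality: with s the scale, each point outside the small ball adds at least 16^s/16
to the optimal cost, which is below 16 |K| 16^s / 512. So at most half of K lies outside. -/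
lemma half_card_le (h : IsActive K μ C) (hC : C.Nonempty) :
    (K.card : ℝ) / 2 ≤ (K.filter fun x => x ∈ ballPoints X μ (scale C μ - 1)).card := by
  have h1 : ((K.filter fun x => x ∉ ballPoints X μ (scale C μ - 1)).card : ℝ) *
      (4 ^ scale C μ) ^ 2 ≤ 16 * centerCost K μ := by
    calc ((K.filter fun x => x ∉ ballPoints X μ (scale C μ - 1)).card : ℝ) * (4 ^ scale C μ) ^ 2
        = ∑ x ∈ K.filter fun x => x ∉ ballPoints X μ (scale C μ - 1),
            ((4 : ℝ) ^ scale C μ) ^ 2 := by simp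
      _ ≤ ∑ x ∈ K.filter fun x => x ∉ ballPoints X μ (scale C μ - 1),
            16 * ‖(x : EuclideanSpace ℝ (Fin d)) - μ‖ ^ 2 := by
          refine Finset.sum_le_sum fun x hx => ?_
          have hx' := (Finset.mem_filter.1 hx).2
          simp only [ballPoints, Finset.mem_filter, Finset.mem_univ, true_and, not_lt] at hx'
          rw [zpow_sub_one₀ (by norm_num)] at hx'
          have : (0 : ℝ) < 4 ^ scale C μ := by positivity
          nlinarith
      _ ≤ ∑ x ∈ K, 16 * ‖(x : EuclideanSpace ℝ (Fin d)) - μ‖ ^ 2 :=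
          Finset.sum_le_sum_of_subset_of_nonneg (Finset.filter_subset _ _)
            fun _ _ _ => by positivity
      _ = _ := by rw [centerCost, Finset.mul_sum]
  have h2 := (h.sqDist_pos_and hC).2.1
  have h3 := h.sqDist_lt hC
  have h4 : ((K.filter fun x => x ∈ ballPoints X μ (scale C μ - 1)).card : ℝ) +
      (K.filter fun x => x ∉ ballPoints X μ (scale C μ - 1)).card = K.card := by
    exact_mod_cast Finset.card_filter_add_card_filter_not _
  have h5 : (0 : ℝ) < (4 ^ scale C μ) ^ 2 := by positivity
  have h6 : (0 : ℝ) ≤ K.card := by positivity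
  have h7 : ((K.filter fun x => x ∉ ballPoints X μ (scale C μ - 1)).card : ℝ) *
      (4 ^ scale C μ) ^ 2 ≤ (K.card / 2) * (4 ^ scale C μ) ^ 2 := by
    nlinarith [mul_le_mul_of_nonneg_left h3.le h6]
  have h8 := le_of_mul_le_mul_right h7 h5
  linarith

lemma card_pos (h : IsActive K μ C) : (0 : ℝ) < K.card := by
  rw [Nat.cast_pos, Finset.card_pos]
  by_contra hne
  have h2 := h.2
  rw [Finset.not_nonempty_iff_eq_empty.1 hne] at h2
  simp [costOn, centerCost] at h2

lemma half_card_le_nearCount (h : IsActive K μ C) (hC : C.Nonempty) :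
    (K.card : ℝ) / 2 ≤ nearCount C μ := by
  refine (h.half_card_le hC).trans (le_trans ?_ (ballPoints_pred_le_nearCount C μ))
  exact_mod_cast Finset.card_le_card fun x hx => (Finset.mem_filter.1 hx).2

lemma nearCount_pos (h : IsActive K μ C) (hC : C.Nonempty) : 0 < nearCount C μ :=
  lt_of_lt_of_le (half_pos h.card_pos) (h.half_card_le_nearCount hC)

lemma centerGain_pos (h : IsActive K μ C) (hC : C.Nonempty) : 0 < centerGain C μ :=
  mul_pos (h.nearCount_pos hC) (by positivity)

lemma ratio_le_two (h : IsActive K μ C) (hC : C.Nonempty) :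
    (K.card : ℝ) / nearCount C μ ≤ 2 := by
  rw [div_le_iff₀ (h.nearCount_pos hC)]
  linarith [h.half_card_le_nearCount hC]

lemma le_sqDist_of_mem_ball (h : IsActive K μ C) (hC : C.Nonempty) {x : X}
    (hx : x ∈ ballPoints X μ (scale C μ - 1)) :
    9 / 16 * ((4 : ℝ) ^ scale C μ) ^ 2 ≤ sqDist C x := by
  simp only [ballPoints, Finset.mem_filter, Finset.mem_univ, true_and] at hx
  rw [zpow_sub_one₀ (by norm_num)] at hx
  have h1 := sqDist_le_add_sq hC μ x
  have h2 := (h.sqrt_bounds hC).1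
  have h3 : √(sqDist C μ) ≤ ‖μ - x‖ + √(sqDist C x) :=
    Real.sqrt_le_iff.2 ⟨by positivity, h1⟩
  rw [norm_sub_rev] at h3
  have h4 : 3 / 4 * (4 : ℝ) ^ scale C μ ≤ √(sqDist C x) := by linarith
  have h5 := Real.sq_sqrt (sqDist_nonneg C x)
  have h6 : (0 : ℝ) < 4 ^ scale C μ := by positivity
  nlinarith

/-- Points of the small ball are at distance at least (3/4) 4^s from the old centers and at most
(1/2) 4^s from c. Each saves (9/16 - 1/4) 16^s, and there are at least `nearCount`/2 of them. -/
lemma gain_le_drop (h : IsActive K μ C) (hC : C.Nonempty) {c : X}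
    (hc : c ∈ ballPoints X μ (scale C μ - 1)) :
    5 / 32 * centerGain C μ ≤ costOn Finset.univ C - costOn Finset.univ (insert c C) := by
  have h1 (x : X) (hx : x ∈ ballPoints X μ (scale C μ - 1)) :
      5 / 16 * ((4 : ℝ) ^ scale C μ) ^ 2 ≤ sqDist C x - sqDist (insert c C) x := by
    have h2 := h.le_sqDist_of_mem_ball hC hx
    have h3 := sqDist_le (Finset.mem_insert_self c C) x
    simp only [ballPoints, Finset.mem_filter, Finset.mem_univ, true_and] at hx hc
    rw [zpow_sub_one₀ (by norm_num)] at hx hc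
    have h4 := norm_sub_le_norm_sub_add_norm_sub (x : EuclideanSpace ℝ (Fin d)) μ c
    rw [norm_sub_rev μ] at h4
    have h5 : ‖(x : EuclideanSpace ℝ (Fin d)) - c‖ ≤ 1 / 2 * 4 ^ scale C μ := by linarith
    have h6 := norm_nonneg ((x : EuclideanSpace ℝ (Fin d)) - c)
    nlinarith
  calc 5 / 32 * centerGain C μ
      = nearCount C μ * (5 / 32 * (4 ^ scale C μ) ^ 2) := by rw [centerGain]; ring
    _ ≤ (2 * (ballPoints X μ (scale C μ - 1)).card) * (5 / 32 * (4 ^ scale C μ) ^ 2) := by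
        gcongr
        exact nearCount_le_two_mul C μ
    _ = ∑ x ∈ ballPoints X μ (scale C μ - 1), 5 / 16 * ((4 : ℝ) ^ scale C μ) ^ 2 := by
        rw [Finset.sum_const, nsmul_eq_mul]
        ring
    _ ≤ ∑ x ∈ ballPoints X μ (scale C μ - 1), (sqDist C x - sqDist (insert c C) x) :=
        Finset.sum_le_sum h1
    _ ≤ ∑ x : X, (sqDist C x - sqDist (insert c C) x) :=
        Finset.sum_le_sum_of_subset_of_nonneg (Finset.subset_univ _)
          fun x _ _ => sub_nonneg.2 (sqDist_insert_le hC c x)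
    _ = _ := by rw [Finset.sum_sub_distrib]; rfl

lemma centerGain_le_cost (h : IsActive K μ C) (hC : C.Nonempty) :
    9 / 32 * centerGain C μ ≤ costOn Finset.univ C := by
  calc 9 / 32 * centerGain C μ
      = nearCount C μ * (9 / 32 * (4 ^ scale C μ) ^ 2) := by rw [centerGain]; ring
    _ ≤ (2 * (ballPoints X μ (scale C μ - 1)).card) * (9 / 32 * (4 ^ scale C μ) ^ 2) := by
        gcongr
        exact nearCount_le_two_mul C μ
    _ = ∑ x ∈ ballPoints X μ (scale C μ - 1), 9 / 16 * ((4 : ℝ) ^ scale C μ) ^ 2 := by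
        rw [Finset.sum_const, nsmul_eq_mul]
        ring
    _ ≤ costOn (ballPoints X μ (scale C μ - 1)) C :=
        Finset.sum_le_sum fun x hx => h.le_sqDist_of_mem_ball hC hx
    _ ≤ _ := costOn_le_univ _ _

lemma cost_pos (h : IsActive K μ C) (hC : C.Nonempty) : 0 < costOn Finset.univ C :=
  lt_of_lt_of_le (mul_pos (by norm_num) (h.centerGain_pos hC)) (h.centerGain_le_cost hC)

/-- Together with `costOn_le` this pins the cost of K to |K| 16^s up to constants, which translates
between the share of K and `centerGain`. -/
lemma le_costOn (h : IsActive K μ C) (hC : C.Nonempty) :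
    9 / 32 * (K.card * (4 ^ scale C μ) ^ 2) ≤ costOn K C := by
  calc 9 / 32 * ((K.card : ℝ) * (4 ^ scale C μ) ^ 2)
      = (K.card / 2) * (9 / 16 * (4 ^ scale C μ) ^ 2) := by ring
    _ ≤ ((K.filter fun x => x ∈ ballPoints X μ (scale C μ - 1)).card : ℝ) *
          (9 / 16 * (4 ^ scale C μ) ^ 2) := by
        gcongr
        exact h.half_card_le hC
    _ = ∑ x ∈ K.filter fun x => x ∈ ballPoints X μ (scale C μ - 1),
          9 / 16 * ((4 : ℝ) ^ scale C μ) ^ 2 := by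
        rw [Finset.sum_const, nsmul_eq_mul]
    _ ≤ ∑ x ∈ K.filter fun x => x ∈ ballPoints X μ (scale C μ - 1), sqDist C x :=
        Finset.sum_le_sum fun x hx =>
          h.le_sqDist_of_mem_ball hC (Finset.mem_filter.1 hx).2
    _ ≤ costOn K C :=
        Finset.sum_le_sum_of_subset_of_nonneg (Finset.filter_subset _ _)
          fun _ _ _ => sqDist_nonneg _ _

lemma costOn_le (h : IsActive K μ C) (hC : C.Nonempty) :
    costOn K C ≤ 64 * (K.card * (4 ^ scale C μ) ^ 2) := by
  have h1 := (h.sqDist_pos_and hC).1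
  have h2 := mul_le_mul_of_nonneg_left (h.sqDist_lt hC).le h.card_pos.le
  linarith

/-- Outside the small ball 4^s ≤ 4 ‖x - μ‖, so a point costs at most (2 + 2·16·16) ‖x - μ‖². The
threshold 2048 makes this at most half of the cost of K. -/
lemma half_costOn_le (h : IsActive K μ C) (hC : C.Nonempty) :
    costOn K C / 2 ≤ costOn (K.filter fun x => x ∈ ballPoints X μ (scale C μ - 1)) C := by
  have h1 : costOn (K.filter fun x => x ∉ ballPoints X μ (scale C μ - 1)) C ≤
      514 * centerCost K μ := by
    calc costOn (K.filter fun x => x ∉ ballPoints X μ (scale C μ - 1)) C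
        ≤ ∑ x ∈ K.filter fun x => x ∉ ballPoints X μ (scale C μ - 1),
            514 * ‖(x : EuclideanSpace ℝ (Fin d)) - μ‖ ^ 2 := by
          refine Finset.sum_le_sum fun x hx => ?_
          have hx' := (Finset.mem_filter.1 hx).2
          simp only [ballPoints, Finset.mem_filter, Finset.mem_univ, true_and, not_lt] at hx'
          rw [zpow_sub_one₀ (by norm_num)] at hx'
          have h2 := sqDist_le_two_mul hC (x : EuclideanSpace ℝ (Fin d)) μ
          have h3 := h.sqDist_lt hC
          have : (0 : ℝ) < 4 ^ scale C μ := by positivity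
          nlinarith
      _ ≤ ∑ x ∈ K, 514 * ‖(x : EuclideanSpace ℝ (Fin d)) - μ‖ ^ 2 :=
          Finset.sum_le_sum_of_subset_of_nonneg (Finset.filter_subset _ _)
            fun _ _ _ => by positivity
      _ = _ := by rw [centerCost, Finset.mul_sum]
  have h2 : costOn (K.filter fun x => x ∈ ballPoints X μ (scale C μ - 1)) C +
      costOn (K.filter fun x => x ∉ ballPoints X μ (scale C μ - 1)) C = costOn K C :=
    Finset.sum_filter_add_sum_filter_not _ _ _
  have h3 := h.2
  have h4 := centerCost_nonneg K μ
  linarith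

lemma costOn_slowPoints_le (h : IsActive K μ C) (hC : C.Nonempty) {δ : ℝ} (hδ : 0 ≤ δ)
    (hδ' : δ ≤ 1 / 2) :
    costOn (slowPoints δ μ C) C ≤ 25 * δ * centerGain C μ := by
  calc costOn (slowPoints δ μ C) C
      ≤ ∑ x ∈ slowPoints δ μ C, 25 * ((4 : ℝ) ^ scale C μ) ^ 2 := by
        refine Finset.sum_le_sum fun x hx => ?_
        have hx' := (Finset.mem_filter.1 hx).1
        simp only [ballPoints, Finset.mem_filter, Finset.mem_univ, true_and] at hx'
        have h1 := sqDist_le_add_sq hC (x : EuclideanSpace ℝ (Fin d)) μ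
        have h2 := (h.sqrt_bounds hC).2
        refine h1.trans ?_
        calc (‖(x : EuclideanSpace ℝ (Fin d)) - μ‖ + √(sqDist C μ)) ^ 2
            ≤ (5 * 4 ^ scale C μ) ^ 2 := by
              gcongr
              linarith
          _ = _ := by ring
    _ = (slowPoints δ μ C).card * (25 * ((4 : ℝ) ^ scale C μ) ^ 2) := by
        rw [Finset.sum_const, nsmul_eq_mul]
    _ ≤ (δ * nearCount C μ) * (25 * ((4 : ℝ) ^ scale C μ) ^ 2) := by
        gcongr
        exact card_slowPoints_le hδ hδ' C μ
    _ = _ := by rw [centerGain]; ring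

/-- The shift by 4 in `logRatio` compensates log(9/32) > -3. The lower bound 1 becomes the profit of
a scale drop at a point that is not slow. -/
lemma one_le_logRatio (h : IsActive K μ C) (hC : C.Nonempty) {L : ℝ} (hL : 1 ≤ L) :
    1 ≤ logRatio L μ C := by
  refine le_min hL ?_
  have h1 : 9 / 32 ≤ costOn Finset.univ C / centerGain C μ := by
    rw [le_div_iff₀ (h.centerGain_pos hC)]
    exact h.centerGain_le_cost hC
  have h2 := Real.one_sub_inv_le_log_of_pos (show (0 : ℝ) < 9 / 32 by norm_num)
  have h3 := Real.log_le_log (by norm_num) h1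
  norm_num at h2
  linarith

end IsActive

end ClusterPotential

/-! ### Expected decrease of the cluster potential -/

section Transition

variable {d : ℕ} {X : Finset (EuclideanSpace ℝ (Fin d))} {K C : Finset X}
  {μ : EuclideanSpace ℝ (Fin d)} {L M : ℝ}

lemma logRatio_le : logRatio L μ C ≤ L := min_le_left _ _

lemma scale_insert_le {c : X} (hC : C.Nonempty) (hD : 0 < sqDist (insert c C) μ) :
    scale (insert c C) μ ≤ scale C μ :=
  Int.log_mono_right hD (sqDist_insert_le hC c μ)

/-- If the scale at `μ` drops, then the number of near points drops to the number of points that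
are closer than the new center. -/
lemma nearCount_insert_le {c : X} (hC : C.Nonempty) (hD : 0 < sqDist (insert c C) μ)
    (hlt : scale (insert c C) μ < scale C μ) :
    c ∈ ballPoints X μ (scale C μ) ∧ nearCount (insert c C) μ ≤
      min ((ballPoints X μ (scale C μ - 1)).card : ℝ) (closerPoints μ c).card := by
  -- A changed scale means that c is now nearest to μ, at a distance between 4^s' and 4^(s'+1) for
  -- the new scale s'. Hence all points of the ball of radius 4^s' are closer than c.
  have hne : sqDist (insert c C) μ ≠ sqDist C μ := fun h => by
    unfold scale at hlt
    rw [h] at hlt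
    exact lt_irrefl _ hlt
  have heq := (sqDist_insert_eq_or hC c μ).resolve_left hne
  rw [norm_sub_rev] at heq
  have h16 (m : ℤ) : (16 : ℝ) ^ m = (4 ^ m) ^ 2 := by
    rw [show (16 : ℝ) = 4 * 4 by norm_num, mul_zpow, sq]
  have h1 := Int.zpow_log_le_self (b := 16) (by norm_num) hD
  have h2 := Int.lt_zpow_succ_log_self (b := 16) (by norm_num) (sqDist (insert c C) μ)
  rw [Nat.cast_ofNat, h16, heq] at h1 h2
  have h3 : (4 : ℝ) ^ scale (insert c C) μ ≤ ‖(c : EuclideanSpace ℝ (Fin d)) - μ‖ := by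
    rw [scale, heq]
    exact (sq_le_sq₀ (by positivity) (norm_nonneg _)).1 h1
  have h4 : ‖(c : EuclideanSpace ℝ (Fin d)) - μ‖ < (4 : ℝ) ^ (scale (insert c C) μ + 1) := by
    rw [scale, heq]
    exact (sq_lt_sq₀ (norm_nonneg _) (by positivity)).1 h2
  refine ⟨?_, (nearCount_le_ballPoints _ _).trans (le_min ?_ ?_)⟩
  · simp only [ballPoints, Finset.mem_filter, Finset.mem_univ, true_and]
    exact h4.trans_le (zpow_le_zpow_right₀ (by norm_num) (by omega))
  · exact_mod_cast Finset.card_le_card (ballPoints_mono (by omega))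
  · refine Nat.cast_le.2 (Finset.card_le_card fun x hx => ?_)
    simp only [ballPoints, closerPoints, Finset.mem_filter, Finset.mem_univ, true_and] at hx ⊢
    exact hx.trans_le h3

namespace IsActive

lemma clusterPotential_eq (h : IsActive K μ C) :
    clusterPotential L M K μ C = -(K.card / nearCount C μ * (M - logRatio L μ C)) :=
  if_pos h

lemma neg_two_mul_le_clusterPotential (h : IsActive K μ C) (hC : C.Nonempty) (hL : 1 ≤ L)
    (hM : 2 * L ≤ M) : -(2 * M) ≤ clusterPotential L M K μ C := by
  rw [h.clusterPotential_eq]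
  have h1 := h.ratio_le_two hC
  have h2 := h.one_le_logRatio hC hL
  have h3 := logRatio_le (L := L) (μ := μ) (C := C)
  have h4 : 0 < K.card / nearCount C μ := div_pos h.card_pos (h.nearCount_pos hC)
  nlinarith

/-- Active values are at least -2M because |K|/`nearCount` ≤ 2, and the inactive value is -4M. -/
lemma clusterPotential_le_sub_of_not (h : IsActive K μ C) (hC : C.Nonempty) (hL : 1 ≤ L)
    (hM : 2 * L ≤ M) {C' : Finset X} (h' : ¬ IsActive K μ C') :
    clusterPotential L M K μ C' ≤ clusterPotential L M K μ C - 2 * M := by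
  have := h.neg_two_mul_le_clusterPotential hC hL hM
  rw [clusterPotential, if_neg h']
  linarith

lemma not_isActive_insert {c : X} (hc : c ∈ K) : ¬ IsActive K μ (insert c C) := fun h =>
  Finset.disjoint_left.1 h.1 (Finset.mem_insert_self c C) hc

lemma gain_div_cost_le (h : IsActive K μ C) (hC : C.Nonempty) :
    centerGain C μ / costOn Finset.univ C ≤ 32 / 9 := by
  rw [div_le_iff₀ (h.cost_pos hC)]
  linarith [h.centerGain_le_cost hC]

/-- The change of the potential if the scale stays the same. -/
lemma clusterPotential_le_of_scale_eq (h : IsActive K μ C) (hC : C.Nonempty) {c : X}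
    (h' : IsActive K μ (insert c C)) (hs : scale (insert c C) μ = scale C μ) :
    clusterPotential L M K μ (insert c C) ≤ clusterPotential L M K μ C ∧
    (5 / 32 * centerGain C μ ≤ costOn Finset.univ C - costOn Finset.univ (insert c C) →
      4 + Real.log (costOn Finset.univ C / centerGain C μ) ≤ L →
      clusterPotential L M K μ (insert c C) ≤ clusterPotential L M K μ C -
        5 / 32 * (K.card / nearCount C μ * (centerGain C μ / costOn Finset.univ C))) := by
  have hn : nearCount (insert c C) μ = nearCount C μ := by
    unfold nearCount
    rw [hs]
  have hG : centerGain (insert c C) μ = centerGain C μ := by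
    unfold centerGain
    rw [hs, hn]
  have hρ : 0 < K.card / nearCount C μ := div_pos h.card_pos (h.nearCount_pos hC)
  have hΦ' := h'.cost_pos (Finset.insert_nonempty c C)
  have hΦ := h.cost_pos hC
  have hG0 := h.centerGain_pos hC
  rw [h.clusterPotential_eq, h'.clusterPotential_eq, hn]
  constructor
  · have hz : logRatio L μ (insert c C) ≤ logRatio L μ C := by
      unfold logRatio
      rw [hG]
      gcongr
      exact costOn_insert_le hC c _
    nlinarith
  · intro hdrop hlog
    have hz : logRatio L μ (insert c C) ≤
        logRatio L μ C - 5 / 32 * (centerGain C μ / costOn Finset.univ C) := by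
      -- By `hlog` the truncation at L is not in force, so a relative drop of the cost lowers the
      -- logarithm.
      have h1 : logRatio L μ C = 4 + Real.log (costOn Finset.univ C / centerGain C μ) :=
        min_eq_right hlog
      have h2 : logRatio L μ (insert c C) ≤
          4 + Real.log (costOn Finset.univ (insert c C) / centerGain C μ) := by
        unfold logRatio
        rw [hG]
        exact min_le_right _ _
      rw [Real.log_div hΦ.ne' hG0.ne'] at h1
      rw [Real.log_div hΦ'.ne' hG0.ne'] at h2
      have h3 := Real.log_le_sub_one_of_pos (div_pos hΦ' hΦ)
      rw [Real.log_div hΦ'.ne' hΦ.ne'] at h3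
      have h4 : costOn Finset.univ (insert c C) / costOn Finset.univ C ≤
          1 - 5 / 32 * (centerGain C μ / costOn Finset.univ C) := by
        rw [div_le_iff₀ hΦ]
        field_simp
        linarith
      linarith
    nlinarith

/-- The change of the potential if the scale drops. -/
lemma clusterPotential_le_of_scale_lt (h : IsActive K μ C) (hC : C.Nonempty) (hL : 1 ≤ L)
    (hM : 2 * L ≤ M) {c : X} (h' : IsActive K μ (insert c C))
    (hs : scale (insert c C) μ < scale C μ) :
    clusterPotential L M K μ (insert c C) ≤
      clusterPotential L M K μ C + K.card / nearCount C μ * L ∧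
    (c ∉ slowPoints (L / M) μ C → clusterPotential L M K μ (insert c C) ≤
      clusterPotential L M K μ C - K.card / nearCount C μ) := by
  have hC' := Finset.insert_nonempty c C
  have hK := h.card_pos
  have hN := h.nearCount_pos hC
  have hN' := h'.nearCount_pos hC'
  have hz := h.one_le_logRatio hC hL
  have hz' := logRatio_le (L := L) (μ := μ) (C := insert c C)
  obtain ⟨hc, hle⟩ := nearCount_insert_le hC (h'.sqDist_pos_and hC').2.2 hs
  rw [h.clusterPotential_eq, h'.clusterPotential_eq]
  have hρ : 0 < K.card / nearCount C μ := div_pos hK hN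
  have hρ' : 0 < K.card / nearCount (insert c C) μ := div_pos hK hN'
  constructor
  · have h1 : K.card / nearCount C μ ≤ K.card / nearCount (insert c C) μ := by
      have := hle.trans ((min_le_left _ _).trans (ballPoints_pred_le_nearCount C μ))
      gcongr
    nlinarith
  · intro hslow
    have h1 : nearCount (insert c C) μ ≤ (1 - L / M) * nearCount C μ := by
      refine hle.trans (not_lt.1 fun hlt => hslow ?_)
      exact Finset.mem_filter.2 ⟨hc, hlt⟩
    have hM0 : 0 < M := by linarith
    have h2 : nearCount (insert c C) μ * M ≤ (M - L) * nearCount C μ := by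
      calc nearCount (insert c C) μ * M ≤ ((1 - L / M) * nearCount C μ) * M := by gcongr
        _ = _ := by field_simp
    -- The growth of |K|/`nearCount` pays even for a reset of the logarithm to L, with a surplus of
    -- the old ratio times the old `logRatio`.
    have h3 : K.card / nearCount C μ * M ≤ K.card / nearCount (insert c C) μ * (M - L) := by
      rw [div_mul_eq_mul_div, div_mul_eq_mul_div, div_le_div_iff₀ hN hN']
      nlinarith
    nlinarith

/-- The change of the potential in one step, for every choice of the new center. -/
lemma clusterPotential_insert_le (h : IsActive K μ C) (hC : C.Nonempty) (hL : 1 ≤ L)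
    (hM : 2 * L ≤ M) (c : X) :
    clusterPotential L M K μ (insert c C) ≤ clusterPotential L M K μ C +
      K.card / nearCount C μ * L * (if c ∈ slowPoints (L / M) μ C then 1 else 0) := by
  have hρ : 0 < K.card / nearCount C μ := div_pos h.card_pos (h.nearCount_pos hC)
  have hnn : 0 ≤ K.card / nearCount C μ * L * (if c ∈ slowPoints (L / M) μ C then 1 else 0) := by
    have : 0 ≤ L := by linarith
    positivity
  by_cases h' : IsActive K μ (insert c C)
  · rcases (scale_insert_le hC (h'.sqDist_pos_and (Finset.insert_nonempty c C)).2.2).eq_or_lt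
      with hs | hs
    · linarith [(h.clusterPotential_le_of_scale_eq (L := L) (M := M) hC h' hs).1]
    · obtain ⟨h1, h2⟩ := h.clusterPotential_le_of_scale_lt hC hL hM h' hs
      split_ifs with hc
      · linarith
      · linarith [h2 hc]
  · linarith [h.clusterPotential_le_sub_of_not hC hL hM h']

/-- The change of the potential in one step if the new center decreases the cost a lot. -/
lemma clusterPotential_insert_le_of_drop (h : IsActive K μ C) (hC : C.Nonempty) (hL : 1 ≤ L)
    (hM : 2 * L ≤ M) {c : X}
    (hdrop : 5 / 32 * centerGain C μ ≤ costOn Finset.univ C - costOn Finset.univ (insert c C))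
    (hlog : 4 + Real.log (costOn Finset.univ C / centerGain C μ) ≤ L) :
    clusterPotential L M K μ (insert c C) ≤ clusterPotential L M K μ C -
      5 / 32 * (K.card / nearCount C μ * (centerGain C μ / costOn Finset.univ C)) +
      2 * (K.card / nearCount C μ * L) * (if c ∈ slowPoints (L / M) μ C then 1 else 0) := by
  have hρ : 0 < K.card / nearCount C μ := div_pos h.card_pos (h.nearCount_pos hC)
  have hρ2 := h.ratio_le_two hC
  have hy := h.gain_div_cost_le hC
  have hy0 : 0 < centerGain C μ / costOn Finset.univ C :=
    div_pos (h.centerGain_pos hC) (h.cost_pos hC)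
  have hρy : 5 / 32 * (K.card / nearCount C μ * (centerGain C μ / costOn Finset.univ C)) ≤
      K.card / nearCount C μ := by nlinarith
  have hnn : 0 ≤ 2 * (K.card / nearCount C μ * L) *
      (if c ∈ slowPoints (L / M) μ C then 1 else 0) := by
    have : 0 ≤ L := by linarith
    positivity
  by_cases h' : IsActive K μ (insert c C)
  · rcases (scale_insert_le hC (h'.sqDist_pos_and (Finset.insert_nonempty c C)).2.2).eq_or_lt
      with hs | hs
    · linarith [(h.clusterPotential_le_of_scale_eq (L := L) (M := M) hC h' hs).2 hdrop hlog]
    · obtain ⟨h1, h2⟩ := h.clusterPotential_le_of_scale_lt hC hL hM h' hs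
      split_ifs with hc
      · nlinarith
      · linarith [h2 hc]
  · linarith [h.clusterPotential_le_sub_of_not hC hL hM h']

variable {ℓ : ℕ} {sel : Finset X → (Fin ℓ → X) → Fin ℓ} [Nonempty X]

/-- While `K` is active, the potential decreases in expectation, up to `1 / k`, by a multiple of
the share of `K` in the cost. -/
lemma expect_clusterPotential_le (h : IsActive K μ C) (hC : C.Nonempty) (hℓ : 1 ≤ ℓ) {k : ℕ}
    (hk : 1 ≤ k) (hsel : IsGreedy X sel) (hL : L = 4 + Real.log k) (hM : M = 5000 * ℓ * L ^ 2) :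
    expect (addCenter sel (costDist X (points C)) C) (clusterPotential L M K μ) ≤
      clusterPotential L M K μ C - costOn K C / costOn Finset.univ C / 1600 + 1 / k := by
  have hk' : (1 : ℝ) ≤ k := by exact_mod_cast hk
  have hℓ' : (1 : ℝ) ≤ ℓ := by exact_mod_cast hℓ
  have hL4 : 4 ≤ L := by linarith [Real.log_nonneg hk']
  have hL1 : 1 ≤ L := by linarith
  have hML : 5000 ≤ M := by rw [hM]; nlinarith
  have hM2 : 2 * L ≤ M := by rw [hM]; nlinarith
  have hM0 : 0 < M := by linarith
  have hΦ := h.cost_pos hC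
  have hN := h.nearCount_pos hC
  have hG := h.centerGain_pos hC
  set Φ := costOn Finset.univ C with hΦ_def
  set ρ := K.card / nearCount C μ with hρ_def
  set y := centerGain C μ / Φ with hy_def
  set p := costOn K C / Φ with hp_def
  set F := clusterPotential L M K μ with hF_def
  have hρ : 0 < ρ := div_pos h.card_pos hN
  have hρ2 : ρ ≤ 2 := h.ratio_le_two hC
  have hy : 0 < y := div_pos hG hΦ
  have hρy : ρ * y = K.card * (4 ^ scale C μ) ^ 2 / Φ := by
    rw [hρ_def, hy_def, centerGain]
    field_simp
  have hpy : p ≤ 64 * (ρ * y) := by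
    rw [hρy, hp_def, ← mul_div_assoc]
    gcongr
    exact h.costOn_le hC
  have hyp : 9 / 32 * (ρ * y) ≤ p := by
    rw [hρy, hp_def, ← mul_div_assoc]
    gcongr
    exact h.le_costOn hC
  have hδ0 : 0 ≤ L / M := by positivity
  have hδ : L / M ≤ 1 / 2 := by
    rw [div_le_iff₀ hM0]
    linarith
  set bad : X → ℝ := fun c => if c ∈ slowPoints (L / M) μ C then 1 else 0 with hbad_def
  set W := iidSamples ℓ (costDist X (points C)) with hW
  set B := expect W (fun c => bad (c (sel C c))) with hB_def
  -- A slow choice costs at most ρL or 2ρL and has probability at most 25 ℓ (L/M) y. This fixes M =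
  -- 5000 ℓ L².
  have hB : ρ * L * B ≤ ρ * y / 200 := by
    have h1 : B ≤ ℓ * (25 * (L / M) * y) := by
      calc B ≤ ℓ * expect (costDist X (points C)) bad :=
            expect_iidSamples_sel_le _ (fun a => by rw [hbad_def]; positivity) _
        _ = ℓ * (costOn (slowPoints (L / M) μ C) C / Φ) := by
            rw [hbad_def, expect_costDist_indicator hΦ.ne']
        _ ≤ ℓ * (25 * (L / M) * centerGain C μ / Φ) := by
            gcongr
            exact h.costOn_slowPoints_le hC hδ0 hδ
        _ = _ := by rw [hy_def]; ring
    calc ρ * L * B ≤ ρ * L * (ℓ * (25 * (L / M) * y)) := by gcongr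
      _ = ρ * y / 200 := by
          rw [hM]
          field_simp
          norm_num
  have hW_lin (a b : ℝ) (g : (Fin ℓ → X) → ℝ) :
      expect W (fun c => F C + a * g c + b * bad (c (sel C c))) =
        F C + a * expect W g + b * B := by
    rw [expect_add, expect_add, expect_const, expect_const_mul, expect_const_mul]
  rw [expect_addCenter]
  -- In the other case y < 1/k, so the share of K is O(1/k) and the additive term 1/k absorbs
  -- everything.
  by_cases hlog : 4 + Real.log (Φ / centerGain C μ) ≤ L
  · set drop : X → Prop := fun c =>
      5 / 32 * centerGain C μ ≤ Φ - costOn Finset.univ (insert c C) with hdrop_def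
    have hdrop_sel (c : Fin ℓ → X) (j : Fin ℓ) (hj : drop (c j)) : drop (c (sel C c)) := by
      have := hsel.costOn_le C c j
      simp only [hdrop_def] at hj ⊢
      linarith
    set Q : X → Prop := fun c => c ∉ K ∧ drop c with hQ_def
    -- If strong candidates outside K are rare, then with probability at least p/4 some candidate is
    -- in the near part of K and no strong one is outside. The greedy choice is then strong, hence
    -- in K, and the potential falls by 2M.
    by_cases hQ : expect (costDist X (points C)) (fun c => if Q c then 1 else 0) ≤ 1 / (2 * ℓ)
    · set g : X → Prop := fun c => c ∈ K.filter fun x => x ∈ ballPoints X μ (scale C μ - 1)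
        with hg_def
      have h1 := half_mul_le_expect_exists_and hℓ (costDist X (points C)) g Q
        (fun a ha hqa => hqa.1 (Finset.mem_filter.1 ha).1) hQ
      have h2 : p / 2 ≤ expect (costDist X (points C)) (fun a => if g a then 1 else 0) := by
        rw [expect_costDist_indicator hΦ.ne', hp_def, div_right_comm]
        gcongr
        exact h.half_costOn_le hC
      have h3 : expect W (fun c => F (insert (c (sel C c)) C)) ≤ expect W (fun c => F C +
          (-(2 * M)) * (if (∃ j, g (c j)) ∧ ∀ j, ¬ Q (c j) then 1 else 0) +
            ρ * L * bad (c (sel C c))) := by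
        refine expect_mono fun c => ?_
        have h4 := h.clusterPotential_insert_le hC hL1 hM2 (c (sel C c))
        have hbad0 : 0 ≤ ρ * L * bad (c (sel C c)) := by
          rw [hbad_def]
          positivity
        split_ifs with hc
        · obtain ⟨⟨j, hj⟩, hc⟩ := hc
          have hd := hdrop_sel c j (h.gain_le_drop hC (Finset.mem_filter.1 hj).2)
          have hK : c (sel C c) ∈ K := by
            by_contra hne
            exact hc _ ⟨hne, hd⟩
          have h5 := h.clusterPotential_le_sub_of_not hC hL1 hM2 (not_isActive_insert (C := C) hK)
          linarith
        · linarith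
      rw [hW_lin] at h3
      have hkk : (0 : ℝ) ≤ 1 / k := by positivity
      have h4 := mul_le_mul_of_nonneg_left ((div_le_div_of_nonneg_right h2 (by norm_num :
        (0 : ℝ) ≤ 2)).trans h1) hM0.le
      have h5 := mul_le_mul_of_nonneg_right hML (le_trans (by positivity) hyp)
      linarith
    -- With probability at least 1/3 the greedy choice has a large drop. The constants fit since
    -- 5/96 - 2/200 > 64/1600.
    · have h1 := third_le_expect_exists hℓ (costDist X (points C)) Q (not_le.1 hQ).le
      have h3 : expect W (fun c => F (insert (c (sel C c)) C)) ≤ expect W (fun c => F C +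
          (-(5 / 32 * (ρ * y))) * (if ∃ j, Q (c j) then 1 else 0) +
            2 * (ρ * L) * bad (c (sel C c))) := by
        refine expect_mono fun c => ?_
        have hbad0 : 0 ≤ ρ * L * bad (c (sel C c)) := by
          rw [hbad_def]
          positivity
        split_ifs with hc
        · obtain ⟨j, hj⟩ := hc
          have := h.clusterPotential_insert_le_of_drop hC hL1 hM2 (hdrop_sel c j hj.2) hlog
          linarith
        · have := h.clusterPotential_insert_le hC hL1 hM2 (c (sel C c))
          linarith
      rw [hW_lin] at h3
      have hkk : (0 : ℝ) ≤ 1 / k := by positivity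
      nlinarith
  · have hyk : y ≤ 1 / k := by
      rw [hL, not_le, add_lt_add_iff_left] at hlog
      have := (Real.log_lt_log_iff (by positivity) (by positivity)).1 hlog
      rw [hy_def, div_le_div_iff₀ hΦ (by positivity)]
      rw [lt_div_iff₀ hG] at this
      linarith
    have h3 : expect W (fun c => F (insert (c (sel C c)) C)) ≤
        expect W (fun c => F C + 0 * 0 + ρ * L * bad (c (sel C c))) := by
      refine expect_mono fun c => ?_
      have := h.clusterPotential_insert_le hC hL1 hM2 (c (sel C c))
      linarith
    rw [hW_lin _ _ fun _ => 0] at h3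
    have : ρ * y ≤ 2 * (1 / k) := by gcongr
    linarith

end IsActive

end Transition

/-! ### Induction along the seeding process -/

section Seeding

variable {d ℓ : ℕ} {X : Finset (EuclideanSpace ℝ (Fin d))}
  {sel : Finset X → (Fin ℓ → X) → Fin ℓ}

lemma nonempty_of_addCenter {p : PMF X} {C C' : Finset X} (h : addCenter sel p C C' ≠ 0) :
    C'.Nonempty := by
  obtain ⟨c, _, rfl⟩ := (PMF.mem_support_map_iff _ _ _).1 ((PMF.mem_support_iff _ _).2 h)
  exact Finset.insert_nonempty _ _

variable [Nonempty X]

lemma expect_seeding_add_two (i : ℕ) (f : Finset X → ℝ) :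
    expect (seeding X sel (i + 2)) f =
      expect (seeding X sel (i + 1)) fun C =>
        expect (addCenter sel (costDist X (points C)) C) f :=
  expect_bind _ _ _

lemma nonempty_of_seeding {i : ℕ} {C : Finset X} (h : seeding X sel (i + 1) C ≠ 0) :
    C.Nonempty := by
  cases i with
  | zero => exact nonempty_of_addCenter h
  | succ i =>
    obtain ⟨C', _, hC'⟩ := (PMF.mem_support_bind_iff _ _ _).1 ((PMF.mem_support_iff _ _).2 h)
    exact nonempty_of_addCenter ((PMF.mem_support_iff _ _).1 hC')

/-- Steps that increase a potential by at most `g` in expectation. -/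
lemma expect_seeding_succ_le {f f' g : Finset X → ℝ}
    (h : ∀ C : Finset X, C.Nonempty →
      expect (addCenter sel (costDist X (points C)) C) f' ≤ f C + g C) (i : ℕ) :
    expect (seeding X sel (i + 2)) f' ≤
      expect (seeding X sel (i + 1)) f + expect (seeding X sel (i + 1)) g := by
  rw [expect_seeding_add_two, ← expect_add]
  exact expect_mono_of_support fun C hC => h C (nonempty_of_seeding hC)

end Seeding

/-! ### Expected cost of covered clusters -/

section CoveredCost

variable {d ℓ : ℕ} {X : Finset (EuclideanSpace ℝ (Fin d))} {K C : Finset X}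
  {μ : EuclideanSpace ℝ (Fin d)} {L M : ℝ}

/-- A potential which dominates the cost of `K` once `K` contains a center. -/
def coverPotential (ℓ : ℕ) (L M : ℝ) (K : Finset X) (μ : EuclideanSpace ℝ (Fin d))
    (C : Finset X) : ℝ :=
  if Disjoint C K then
    2048 * centerCost K μ + 25600 * ℓ * centerCost K μ * (clusterPotential L M K μ C + 4 * M)
  else costOn K C

lemma clusterPotential_nonpos (hC : C.Nonempty) (hL : 1 ≤ L) (hM : 2 * L ≤ M) :
    clusterPotential L M K μ C ≤ 0 := by
  by_cases h : IsActive K μ C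
  · rw [h.clusterPotential_eq]
    have h3 := logRatio_le (L := L) (μ := μ) (C := C)
    have h4 : 0 < K.card / nearCount C μ := div_pos h.card_pos (h.nearCount_pos hC)
    nlinarith
  · rw [clusterPotential, if_neg h]
    linarith

lemma clusterPotential_add_nonneg (hC : C.Nonempty) (hL : 1 ≤ L) (hM : 2 * L ≤ M) :
    0 ≤ clusterPotential L M K μ C + 4 * M := by
  by_cases h : IsActive K μ C
  · linarith [h.neg_two_mul_le_clusterPotential hC hL hM]
  · rw [clusterPotential, if_neg h]
    linarith

lemma coverPotential_nonneg (hC : C.Nonempty) (hL : 1 ≤ L) (hM : 2 * L ≤ M) :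
    0 ≤ coverPotential ℓ L M K μ C := by
  have h1 := clusterPotential_add_nonneg (K := K) (μ := μ) hC hL hM
  have h2 := centerCost_nonneg K μ
  unfold coverPotential
  split_ifs
  · positivity
  · exact costOn_nonneg K C

lemma disjoint_insert_iff {c : X} : Disjoint (insert c C) K ↔ c ∉ K ∧ Disjoint C K :=
  Finset.disjoint_insert_left

variable {sel : Finset X → (Fin ℓ → X) → Fin ℓ} [Nonempty X]

/-- Since 25600 = 16 · 1600, the decrease p/1600 of the cluster potential pays exactly for the
expected cost 16 ℓ o p of covering K now. An uncovered inactive cluster stays inactive and costs at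
most 2048 o, now or when covered later. -/
lemma expect_coverPotential_le (hC : C.Nonempty) (hℓ : 1 ≤ ℓ) {k : ℕ} (hk : 1 ≤ k)
    (hsel : IsGreedy X sel) (hL : L = 4 + Real.log k) (hM : M = 5000 * ℓ * L ^ 2) :
    expect (addCenter sel (costDist X (points C)) C) (coverPotential ℓ L M K μ) ≤
      coverPotential ℓ L M K μ C + 25600 * ℓ * centerCost K μ / k := by
  have hk' : (1 : ℝ) ≤ k := by exact_mod_cast hk
  have hℓ' : (1 : ℝ) ≤ ℓ := by exact_mod_cast hℓ
  have hL4 : 4 ≤ L := by linarith [Real.log_nonneg hk']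
  have hL1 : 1 ≤ L := by linarith
  have hM2 : 2 * L ≤ M := by rw [hM]; nlinarith
  have ho := centerCost_nonneg K μ
  have hr : 0 ≤ 25600 * ℓ * centerCost K μ / k := by positivity
  have of_pointwise (h : ∀ c, coverPotential ℓ L M K μ (insert c C) ≤
      coverPotential ℓ L M K μ C) :
      expect (addCenter sel (costDist X (points C)) C) (coverPotential ℓ L M K μ) ≤
        coverPotential ℓ L M K μ C + 25600 * ℓ * centerCost K μ / k := by
    rw [expect_addCenter]
    refine le_trans (expect_mono fun c => h _) ?_
    rw [expect_const]
    linarith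
  by_cases hdisj : Disjoint C K
  swap
  · refine of_pointwise fun c => ?_
    rw [coverPotential, coverPotential, if_neg hdisj,
      if_neg fun h => hdisj (disjoint_insert_iff.1 h).2]
    exact costOn_insert_le hC c K
  by_cases h : IsActive K μ C
  swap
  · refine of_pointwise fun c => ?_
    have hle : costOn K C ≤ 2048 * centerCost K μ := not_lt.1 fun hlt => h ⟨hdisj, hlt⟩
    have hle' := costOn_insert_le hC c K
    have h' : ¬ IsActive K μ (insert c C) := fun h' => by linarith [h'.2]
    rw [coverPotential, coverPotential, if_pos hdisj, clusterPotential, clusterPotential,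
      if_neg h, if_neg h']
    split_ifs <;> linarith
  have hΦ := h.cost_pos hC
  have h1 (c : X) : coverPotential ℓ L M K μ (insert c C) ≤
      (2048 * centerCost K μ + 25600 * ℓ * centerCost K μ * (4 * M)) +
        25600 * ℓ * centerCost K μ * clusterPotential L M K μ (insert c C) +
        (if c ∈ K then costOn K (insert c C) else 0) := by
    have h2 := clusterPotential_add_nonneg (K := K) (μ := μ) (Finset.insert_nonempty c C) hL1 hM2
    have h3 : 0 ≤ 25600 * ℓ * centerCost K μ * (clusterPotential L M K μ (insert c C) + 4 * M) :=
      by positivity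
    rw [coverPotential]
    by_cases hc : c ∈ K
    · rw [if_neg fun h => (disjoint_insert_iff.1 h).1 hc, if_pos hc]
      linarith
    · rw [if_pos (disjoint_insert_iff.2 ⟨hc, hdisj⟩), if_neg hc]
      linarith
  have h2 := h.expect_clusterPotential_le hC hℓ hk hsel hL hM
  have h3 := expect_iidSamples_sel_le (costDist X (points C))
    (f := fun c => if c ∈ K then costOn K (insert c C) else 0)
    (fun c => by split_ifs; exacts [costOn_nonneg _ _, le_rfl]) (sel C)
  have h4 : expect (costDist X (points C)) (fun c => if c ∈ K then costOn K (insert c C) else 0) ≤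
      16 * centerCost K μ * (costOn K C / costOn Finset.univ C) := by
    rw [expect_costDist hΦ.ne', ← mul_div_assoc]
    gcongr
    simp only [mul_ite, mul_zero, Finset.sum_ite_mem, Finset.univ_inter]
    exact sum_sqDist_mul_costOn_insert_le hC K μ
  have h5 : expect (addCenter sel (costDist X (points C)) C) (coverPotential ℓ L M K μ) ≤
      (2048 * centerCost K μ + 25600 * ℓ * centerCost K μ * (4 * M)) +
        25600 * ℓ * centerCost K μ *
          expect (addCenter sel (costDist X (points C)) C) (clusterPotential L M K μ) +
        ℓ * (16 * centerCost K μ * (costOn K C / costOn Finset.univ C)) := by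
    rw [expect_addCenter, expect_addCenter]
    refine le_trans (expect_mono fun c => h1 _) ?_
    rw [expect_add, expect_add, expect_const, expect_const_mul]
    gcongr
    exact h3.trans (by gcongr)
  refine h5.trans ?_
  rw [coverPotential, if_pos hdisj]
  have h6 := mul_le_mul_of_nonneg_left h2
    (show 0 ≤ 25600 * ℓ * centerCost K μ by positivity)
  refine le_trans (add_le_add_left (add_le_add_right h6 _) _) (le_of_eq ?_)
  ring

lemma expect_uniformOfFintype (f : X → ℝ) :
    expect (PMF.uniformOfFintype X) f = (∑ c, f c) / Fintype.card X := by
  simp only [expect, PMF.uniformOfFintype_apply, ENNReal.toReal_inv, ENNReal.toReal_natCast,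
    ← Finset.mul_sum]
  ring

/-- A uniform sample hits K with probability |K|/|X| ≤ 1 and then leaves expected cost at most 4 o.
If K is missed, nonpositivity of the cluster potential bounds the value. -/
lemma expect_seeding_one_coverPotential_le (hℓ : 1 ≤ ℓ) (hL : 1 ≤ L) (hM : 2 * L ≤ M) :
    expect (seeding X sel 1) (coverPotential ℓ L M K μ) ≤
      (2048 + 102400 * ℓ * M + 4 * ℓ) * centerCost K μ := by
  have ho := centerCost_nonneg K μ
  have hM0 : 0 ≤ M := by linarith
  have h1 (c : X) : coverPotential ℓ L M K μ (insert c ∅) ≤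
      (2048 * centerCost K μ + 25600 * ℓ * centerCost K μ * (4 * M)) +
        (if c ∈ K then centerCost K c else 0) := by
    have hpos : 0 ≤ 25600 * ℓ * centerCost K μ * (4 * M) := by positivity
    rw [coverPotential]
    by_cases hc : c ∈ K
    · rw [if_neg fun h => (disjoint_insert_iff.1 h).1 hc, if_pos hc]
      have : costOn K (insert c ∅) ≤ centerCost K c :=
        Finset.sum_le_sum fun x _ => sqDist_le (Finset.mem_insert_self _ _) _
      linarith
    · rw [if_pos (disjoint_insert_iff.2 ⟨hc, Finset.disjoint_empty_left _⟩), if_neg hc]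
      have h2 := clusterPotential_nonpos (K := K) (μ := μ) (Finset.insert_nonempty c ∅) hL hM
      rw [add_zero]
      gcongr
      linarith
  have h2 := expect_iidSamples_sel_le (PMF.uniformOfFintype X)
    (f := fun c => if c ∈ K then centerCost K (c : EuclideanSpace ℝ (Fin d)) else 0)
    (fun c => by split_ifs; exacts [centerCost_nonneg _ _, le_rfl]) (sel ∅)
  have h3 : expect (PMF.uniformOfFintype X)
      (fun c => if c ∈ K then centerCost K (c : EuclideanSpace ℝ (Fin d)) else 0) ≤
      4 * centerCost K μ := by
    rw [expect_uniformOfFintype, div_le_iff₀ (by exact_mod_cast Fintype.card_pos)]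
    simp only [Finset.sum_ite_mem, Finset.univ_inter]
    refine (sum_centerCost_le K μ).trans ?_
    have : (K.card : ℝ) ≤ Fintype.card X := by exact_mod_cast Finset.card_le_univ K
    nlinarith
  change expect (addCenter sel (PMF.uniformOfFintype X) ∅) _ ≤ _
  rw [expect_addCenter]
  refine le_trans (expect_mono fun c => h1 _) ?_
  rw [expect_add, expect_const]
  have h4 : (ℓ : ℝ) * expect (PMF.uniformOfFintype X)
      (fun c => if c ∈ K then centerCost K (c : EuclideanSpace ℝ (Fin d)) else 0) ≤
      ℓ * (4 * centerCost K μ) := by gcongr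
  linarith

/-- At every time, the expected cost of a part of the data which contains a center is at most
`O(ℓ² log² k)` times its optimal cost. -/
lemma expect_covered_costOn_le (hℓ : 1 ≤ ℓ) {k : ℕ} (hk : 1 ≤ k) (hsel : IsGreedy X sel)
    (K : Finset X) (μ : EuclideanSpace ℝ (Fin d)) {i : ℕ} (hi : i ≤ k) :
    expect (seeding X sel (i + 1)) (fun C => if Disjoint C K then 0 else costOn K C) ≤
      600000000 * ℓ ^ 2 * (4 + Real.log k) ^ 2 * centerCost K μ := by
  have hk' : (1 : ℝ) ≤ k := by exact_mod_cast hk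
  have hℓ' : (1 : ℝ) ≤ ℓ := by exact_mod_cast hℓ
  obtain ⟨L, hL⟩ : ∃ L, L = 4 + Real.log k := ⟨_, rfl⟩
  obtain ⟨M, hM⟩ : ∃ M, M = 5000 * ℓ * L ^ 2 := ⟨_, rfl⟩
  have hL4 : 4 ≤ L := by linarith [Real.log_nonneg hk']
  have hL1 : 1 ≤ L := by linarith
  have hM2 : 2 * L ≤ M := by rw [hM]; nlinarith
  have ho := centerCost_nonneg K μ
  have h1 : expect (seeding X sel (i + 1)) (coverPotential ℓ L M K μ) ≤
      (2048 + 102400 * ℓ * M + 4 * ℓ) * centerCost K μ +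
        i * (25600 * ℓ * centerCost K μ / k) := by
    clear hi
    induction i with
    | zero => simpa using expect_seeding_one_coverPotential_le hℓ hL1 hM2
    | succ i ih =>
      have := expect_seeding_succ_le
        (g := fun _ => 25600 * ℓ * centerCost K μ / k)
        (fun C hC => expect_coverPotential_le (K := K) (μ := μ) hC hℓ hk hsel hL hM) i
      rw [expect_const] at this
      push_cast
      linarith
  have h2 : expect (seeding X sel (i + 1)) (fun C => if Disjoint C K then 0 else costOn K C) ≤
      expect (seeding X sel (i + 1)) (coverPotential ℓ L M K μ) := by
    refine expect_mono_of_support fun C hC => ?_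
    have := coverPotential_nonneg (ℓ := ℓ) (K := K) (μ := μ) (nonempty_of_seeding hC) hL1 hM2
    split_ifs with h
    · exact this
    · rw [coverPotential, if_neg h]
  have h3 : i * (25600 * ℓ * centerCost K μ / k) ≤ 25600 * ℓ * centerCost K μ := by
    have hi' : (i : ℝ) ≤ k := by exact_mod_cast hi
    calc (i : ℝ) * (25600 * ℓ * centerCost K μ / k) ≤ k * (25600 * ℓ * centerCost K μ / k) := by
          gcongr
      _ = _ := by field_simp
  have h4 : (2048 + 102400 * ℓ * M + 4 * ℓ) + 25600 * ℓ ≤ 600000000 * ℓ ^ 2 * L ^ 2 := by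
    have hℓL : 16 * (ℓ : ℝ) ≤ ℓ ^ 2 * L ^ 2 := by
      have : (ℓ : ℝ) ≤ ℓ ^ 2 := by nlinarith
      have : 16 ≤ L ^ 2 := by nlinarith
      nlinarith
    rw [hM]
    nlinarith
  rw [← hL]
  have h5 := mul_le_mul_of_nonneg_right h4 ho
  linarith

end CoveredCost

/-! ### Missed clusters and the recursion over the steps -/

section Clustering

variable {d ℓ : ℕ} {X : Finset (EuclideanSpace ℝ (Fin d))}

/-- The data points which the clustering `a` assigns to the center `t`. -/
def cluster (a : X → EuclideanSpace ℝ (Fin d)) (t : EuclideanSpace ℝ (Fin d)) : Finset X :=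
  Finset.univ.filter fun x => a x = t

/-- The clusters without a center. -/
def uncovered (T : Finset (EuclideanSpace ℝ (Fin d))) (a : X → EuclideanSpace ℝ (Fin d))
    (C : Finset X) : Finset (EuclideanSpace ℝ (Fin d)) :=
  T.filter fun t => Disjoint C (cluster a t)

/-- The total cost of the clusters which contain a center. -/
def coveredCost (T : Finset (EuclideanSpace ℝ (Fin d))) (a : X → EuclideanSpace ℝ (Fin d))
    (C : Finset X) : ℝ :=
  ∑ t ∈ T, if Disjoint C (cluster a t) then 0 else costOn (cluster a t) C

/-- The cost of the clustering. -/
def clusteringCost (T : Finset (EuclideanSpace ℝ (Fin d))) (a : X → EuclideanSpace ℝ (Fin d)) :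
    ℝ :=
  ∑ t ∈ T, centerCost (cluster a t) t

/-- If `r` steps remain, at least `u - r` of the `u` uncovered clusters stay uncovered; each of
them is charged the average cost per uncovered cluster. -/
def missPotential (T : Finset (EuclideanSpace ℝ (Fin d))) (a : X → EuclideanSpace ℝ (Fin d))
    (r : ℕ) (C : Finset X) : ℝ :=
  ((uncovered T a C).card - r : ℕ) * costOn Finset.univ C / (uncovered T a C).card

variable {T : Finset (EuclideanSpace ℝ (Fin d))} {a : X → EuclideanSpace ℝ (Fin d)}
  {C : Finset X}

lemma mem_cluster {x : X} {t : EuclideanSpace ℝ (Fin d)} : x ∈ cluster a t ↔ a x = t := by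
  simp [cluster]

lemma mem_uncovered {t : EuclideanSpace ℝ (Fin d)} :
    t ∈ uncovered T a C ↔ t ∈ T ∧ Disjoint C (cluster a t) :=
  Finset.mem_filter

lemma uncovered_insert (c : X) : uncovered T a (insert c C) = (uncovered T a C).erase (a c) := by
  ext t
  simp only [uncovered, Finset.mem_filter, Finset.mem_erase, disjoint_insert_iff, mem_cluster]
  tauto

lemma coveredCost_nonneg : 0 ≤ coveredCost T a C :=
  Finset.sum_nonneg fun _ _ => by split_ifs; exacts [le_rfl, costOn_nonneg _ _]

lemma clusteringCost_nonneg : 0 ≤ clusteringCost T a :=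
  Finset.sum_nonneg fun _ _ => centerCost_nonneg _ _

lemma missPotential_nonneg {r : ℕ} : 0 ≤ missPotential T a r C :=
  div_nonneg (mul_nonneg (by positivity) (costOn_nonneg _ _)) (by positivity)

lemma sum_cluster (ha : ∀ x, a x ∈ T) (f : X → ℝ) :
    ∑ t ∈ T, ∑ x ∈ cluster a t, f x = ∑ x, f x :=
  Finset.sum_fiberwise_of_maps_to (fun x _ => ha x) f

lemma coveredCost_add_sum (ha : ∀ x, a x ∈ T) (C : Finset X) :
    coveredCost T a C + ∑ t ∈ uncovered T a C, costOn (cluster a t) C =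
      costOn Finset.univ C := by
  rw [coveredCost, uncovered, Finset.sum_filter, ← Finset.sum_add_distrib]
  refine Eq.trans (Finset.sum_congr rfl fun t _ => ?_) (sum_cluster ha _)
  split_ifs <;> simp [costOn]

/-- In this form, division by the total cost gives the probability that a sample falls in a covered
cluster. -/
lemma coveredCost_eq (ha : ∀ x, a x ∈ T) (C : Finset X) :
    coveredCost T a C = ∑ c : X, sqDist C c * if a c ∈ uncovered T a C then 0 else 1 := by
  rw [← sum_cluster ha, coveredCost]
  refine Finset.sum_congr rfl fun t ht => ?_
  split_ifs with h
  · refine (Finset.sum_eq_zero fun x hx => ?_).symm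
    rw [mem_cluster.1 hx, if_pos (mem_uncovered.2 ⟨ht, h⟩), mul_zero]
  · refine Finset.sum_congr rfl fun x hx => ?_
    rw [mem_cluster.1 hx, if_neg fun h' => h (mem_uncovered.1 h').2, mul_one]

/-- The expected decrease of the cost if a single center is sampled. -/
lemma le_card_mul_sum_drop (ha : ∀ x, a x ∈ T) (hC : C.Nonempty) :
    costOn Finset.univ C *
        (costOn Finset.univ C - 2 * (coveredCost T a C + 16 * clusteringCost T a)) ≤
      (uncovered T a C).card *
        ∑ c : X, sqDist C c * (costOn Finset.univ C - costOn Finset.univ (insert c C)) := by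
  set U := uncovered T a C with hU
  set φ : EuclideanSpace ℝ (Fin d) → ℝ := fun t => costOn (cluster a t) C with hφ
  set o : EuclideanSpace ℝ (Fin d) → ℝ := fun t => 16 * centerCost (cluster a t) t with ho
  have hUT : U ⊆ T := Finset.filter_subset _ _
  have hpart (c : X) (t : EuclideanSpace ℝ (Fin d)) :
      costOn (cluster a t) C - costOn (cluster a t) (insert c C) ≤
        costOn Finset.univ C - costOn Finset.univ (insert c C) := by
    simp only [costOn, ← Finset.sum_sub_distrib]
    exact Finset.sum_le_sum_of_subset_of_nonneg (Finset.subset_univ _)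
      fun x _ _ => sub_nonneg.2 (sqDist_insert_le hC c x)
  have hnn (c : X) :
      0 ≤ sqDist C c * (costOn Finset.univ C - costOn Finset.univ (insert c C)) :=
    mul_nonneg (sqDist_nonneg _ _) (sub_nonneg.2 (costOn_insert_le hC c _))
  -- Sampling within cluster t leaves it at most `o t` on average, so it contributes φ (φ - o) to
  -- the weighted drop. Positive parts prepare Cauchy–Schwarz.
  have hcluster (t : EuclideanSpace ℝ (Fin d)) : max (φ t - o t) 0 ^ 2 ≤
      ∑ c ∈ cluster a t,
        sqDist C c * (costOn Finset.univ C - costOn Finset.univ (insert c C)) := by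
    have hot : 0 ≤ o t := mul_nonneg (by norm_num) (centerCost_nonneg _ _)
    have h1 : φ t * (φ t - o t) ≤ ∑ c ∈ cluster a t,
        sqDist C c * (costOn Finset.univ C - costOn Finset.univ (insert c C)) := by
      calc φ t * (φ t - o t)
          ≤ ∑ c ∈ cluster a t, sqDist C c * φ t -
              ∑ c ∈ cluster a t, sqDist C c * costOn (cluster a t) (insert c C) := by
            have := sum_sqDist_mul_costOn_insert_le hC (cluster a t) t
            rw [← Finset.sum_mul]
            change _ ≤ φ t * φ t - _
            nlinarith
        _ = ∑ c ∈ cluster a t,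
              sqDist C c * (costOn (cluster a t) C - costOn (cluster a t) (insert c C)) := by
            rw [← Finset.sum_sub_distrib]
            exact Finset.sum_congr rfl fun c _ => by ring
        _ ≤ _ := Finset.sum_le_sum fun c _ =>
            mul_le_mul_of_nonneg_left (hpart c t) (sqDist_nonneg _ _)
    rcases le_total (φ t - o t) 0 with h | h
    · rw [max_eq_right h]
      simpa using Finset.sum_nonneg fun c _ => hnn c
    · rw [max_eq_left h]
      nlinarith
  have hsum : ∑ t ∈ U, max (φ t - o t) 0 ^ 2 ≤
      ∑ c : X, sqDist C c * (costOn Finset.univ C - costOn Finset.univ (insert c C)) := by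
    rw [← sum_cluster ha]
    exact (Finset.sum_le_sum fun t _ => hcluster t).trans
      (Finset.sum_le_sum_of_subset_of_nonneg hUT fun t _ _ => Finset.sum_nonneg fun c _ => hnn c)
  have hcs : (∑ t ∈ U, max (φ t - o t) 0) ^ 2 ≤ U.card * ∑ t ∈ U, max (φ t - o t) 0 ^ 2 :=
    sq_sum_le_card_mul_sum_sq
  have hA : costOn Finset.univ C - (coveredCost T a C + 16 * clusteringCost T a) ≤
      ∑ t ∈ U, max (φ t - o t) 0 := by
    have h1 : ∑ t ∈ U, (φ t - o t) ≤ ∑ t ∈ U, max (φ t - o t) 0 :=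
      Finset.sum_le_sum fun t _ => le_max_left _ _
    have h2 : ∑ t ∈ U, o t ≤ 16 * clusteringCost T a := by
      rw [clusteringCost, Finset.mul_sum]
      exact Finset.sum_le_sum_of_subset_of_nonneg hUT
        fun t _ _ => mul_nonneg (by norm_num) (centerCost_nonneg _ _)
    have h3 := coveredCost_add_sum ha C
    rw [Finset.sum_sub_distrib] at h1
    linarith
  have hA0 : 0 ≤ ∑ t ∈ U, max (φ t - o t) 0 := Finset.sum_nonneg fun t _ => le_max_right _ _
  have hΦ := costOn_nonneg Finset.univ C
  refine le_trans ?_ (hcs.trans (mul_le_mul_of_nonneg_left hsum (by positivity)))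
  rcases le_total (costOn Finset.univ C) (coveredCost T a C + 16 * clusteringCost T a) with h | h
  · have h1 : costOn Finset.univ C *
        (costOn Finset.univ C - 2 * (coveredCost T a C + 16 * clusteringCost T a)) ≤ 0 :=
      mul_nonpos_of_nonneg_of_nonpos hΦ (by linarith)
    exact h1.trans (sq_nonneg _)
  · have h1 := pow_le_pow_left₀ (sub_nonneg.2 h) hA 2
    nlinarith [sq_nonneg (coveredCost T a C + 16 * clusteringCost T a)]

/-- Covering a new cluster lowers both the number u of uncovered clusters and the number of
remaining steps, so u - r is unchanged up to this shift. A wasted step adds one more average cost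
Φ/u. -/
lemma missPotential_insert_le (hC : C.Nonempty) {r : ℕ} (hr : r + 1 ≤ (uncovered T a C).card)
    (c : X) :
    missPotential T a r (insert c C) ≤
      (((uncovered T a C).card - (r + 1) : ℕ) : ℝ) / ((uncovered T a C).card - 1 : ℕ) *
        costOn Finset.univ (insert c C) +
      costOn Finset.univ C / (uncovered T a C).card *
        (if a c ∈ uncovered T a C then 0 else 1) := by
  have hΦ := costOn_insert_le hC c Finset.univ
  have hΦ' := costOn_nonneg Finset.univ (insert c C)
  rw [missPotential, uncovered_insert]
  set u := (uncovered T a C).card with hu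
  split_ifs with hc
  · rw [Finset.card_erase_of_mem hc, ← hu, show u - 1 - r = u - (r + 1) by omega]
    refine le_of_eq ?_
    ring
  · rw [Finset.erase_eq_of_notMem hc, ← hu, show u - r = u - (r + 1) + 1 by omega, mul_one,
      Nat.cast_add_one, add_mul, add_div, one_mul]
    have hu0 : (0 : ℝ) < u := by exact_mod_cast (show 0 < u by omega)
    refine add_le_add ?_ (by gcongr)
    rcases Nat.eq_zero_or_pos (u - (r + 1)) with h | h
    · simp [h]
    · have h1 : (0 : ℝ) < (u - 1 : ℕ) := by exact_mod_cast (show 0 < u - 1 by omega)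
      have h2 : ((u - 1 : ℕ) : ℝ) ≤ u := by exact_mod_cast Nat.sub_le u 1
      rw [mul_div_right_comm]
      gcongr

lemma missPotential_eq_zero {r : ℕ} (h : (uncovered T a C).card ≤ r) :
    missPotential T a r C = 0 := by
  rw [missPotential, Nat.sub_eq_zero_of_le h]
  simp

/-- With no steps left the potential is the whole cost, unless no cluster is uncovered; then it is
0/0 = 0 and the covered cost is everything. -/
lemma costOn_le_missPotential_add (ha : ∀ x, a x ∈ T) (C : Finset X) :
    costOn Finset.univ C ≤ missPotential T a 0 C + coveredCost T a C := by
  rw [missPotential, Nat.sub_zero]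
  rcases Finset.eq_empty_or_nonempty (uncovered T a C) with h | h
  · have := coveredCost_add_sum ha C
    rw [h, Finset.sum_empty] at this
    rw [h, ← this]
    simp
  · have h1 : ((uncovered T a C).card : ℝ) ≠ 0 := by exact_mod_cast h.card_pos.ne'
    rw [mul_div_cancel_left₀ _ h1]
    linarith [coveredCost_nonneg (T := T) (a := a) (C := C)]

variable {sel : Finset X → (Fin ℓ → X) → Fin ℓ} [Nonempty X]

/-- The greedy choice is at least as good as candidate 0, which is a single sample; no factor ℓ is
lost here. -/
lemma expect_costOn_insert_le (ha : ∀ x, a x ∈ T) (hC : C.Nonempty) (hℓ : 1 ≤ ℓ)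
    (hsel : IsGreedy X sel) (hu : 0 < (uncovered T a C).card)
    (hΦ : costOn Finset.univ C ≠ 0) :
    expect (iidSamples ℓ (costDist X (points C)))
        (fun c => costOn Finset.univ (insert (c (sel C c)) C)) ≤
      costOn Finset.univ C -
        (costOn Finset.univ C - 2 * (coveredCost T a C + 16 * clusteringCost T a)) /
          (uncovered T a C).card := by
  have hu' : (0 : ℝ) < (uncovered T a C).card := by exact_mod_cast hu
  have hΦ0 : 0 < costOn Finset.univ C := lt_of_le_of_ne (costOn_nonneg _ _) hΦ.symm
  calc expect (iidSamples ℓ (costDist X (points C)))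
        (fun c => costOn Finset.univ (insert (c (sel C c)) C))
      ≤ expect (iidSamples ℓ (costDist X (points C)))
          (fun c => costOn Finset.univ (insert (c ⟨0, hℓ⟩) C)) :=
        expect_mono fun c => hsel.costOn_le C c _
    _ = expect (costDist X (points C)) (fun c => costOn Finset.univ (insert c C)) :=
        expect_iidSamples_apply _ (fun c => costOn Finset.univ (insert c C)) _
    _ = costOn Finset.univ C - expect (costDist X (points C))
          (fun c => costOn Finset.univ C - costOn Finset.univ (insert c C)) := by
        rw [expect_sub, expect_const]
        ring
    _ ≤ _ := by
        rw [expect_costDist hΦ]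
        have h := le_card_mul_sum_drop ha hC
        refine sub_le_sub_left ?_ _
        rw [div_le_div_iff₀ hu' hΦ0]
        linarith

/-- With `r + 1` steps remaining, the potential increases in expectation by at most
`O(ℓ / (r + 1))` times the covered and the optimal cost. -/
lemma expect_missPotential_le (ha : ∀ x, a x ∈ T) (hC : C.Nonempty) (hℓ : 1 ≤ ℓ)
    (hsel : IsGreedy X sel) (r : ℕ) :
    expect (addCenter sel (costDist X (points C)) C) (missPotential T a r) ≤
      missPotential T a (r + 1) C +
        (ℓ + 2) / (r + 1) * (coveredCost T a C + 16 * clusteringCost T a) := by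
  have hS := coveredCost_nonneg (T := T) (a := a) (C := C)
  have hO := clusteringCost_nonneg (T := T) (a := a)
  have hΨ := missPotential_nonneg (T := T) (a := a) (C := C) (r := r + 1)
  have hR : 0 ≤ (ℓ + 2 : ℝ) / (r + 1) * (coveredCost T a C + 16 * clusteringCost T a) := by
    positivity
  rw [expect_addCenter]
  have of_pointwise (h : ∀ c, missPotential T a r (insert c C) ≤ 0) :
      expect (iidSamples ℓ (costDist X (points C)))
        (fun c => missPotential T a r (insert (c (sel C c)) C)) ≤
      missPotential T a (r + 1) C +
        (ℓ + 2) / (r + 1) * (coveredCost T a C + 16 * clusteringCost T a) := by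
    refine le_trans (expect_mono fun c => h _) ?_
    rw [expect_const]
    linarith
  by_cases hr : r + 1 ≤ (uncovered T a C).card
  swap
  · refine of_pointwise fun c => (missPotential_eq_zero ?_).le
    rw [uncovered_insert]
    exact (Finset.card_erase_le).trans (by omega)
  by_cases hΦ : costOn Finset.univ C = 0
  · refine of_pointwise fun c => ?_
    have h1 : costOn Finset.univ (insert c C) = 0 :=
      le_antisymm (hΦ ▸ costOn_insert_le hC c _) (costOn_nonneg _ _)
    rw [missPotential, h1]
    simp
  have hΦ0 : 0 < costOn Finset.univ C := lt_of_le_of_ne (costOn_nonneg _ _) (Ne.symm hΦ)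
  have h1 := expect_costOn_insert_le (T := T) ha hC hℓ hsel (by omega) hΦ
  have h2 : expect (iidSamples ℓ (costDist X (points C)))
      (fun c => if a (c (sel C c)) ∈ uncovered T a C then 0 else 1) ≤
      ℓ * (coveredCost T a C / costOn Finset.univ C) := by
    have := expect_iidSamples_sel_le (costDist X (points C))
      (f := fun c => if a c ∈ uncovered T a C then 0 else 1)
      (fun c => by split_ifs <;> norm_num) (sel C)
    rwa [expect_costDist hΦ, ← coveredCost_eq ha] at this
  have h3 : expect (iidSamples ℓ (costDist X (points C)))
        (fun c => missPotential T a r (insert (c (sel C c)) C)) ≤ _ :=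
    expect_mono fun c => missPotential_insert_le hC hr _
  rw [expect_add, expect_const_mul, expect_const_mul] at h3
  rw [missPotential]
  set u := (uncovered T a C).card with hu
  set Φ := costOn Finset.univ C with hΦ_def
  set S := coveredCost T a C with hS_def
  set S' := S + 16 * clusteringCost T a with hS'_def
  have hSS' : S ≤ S' := by linarith
  have hu0 : (0 : ℝ) < u := by exact_mod_cast (show 0 < u by omega)
  have hru : (r + 1 : ℝ) ≤ u := by exact_mod_cast hr
  have hr0 : (0 : ℝ) < r + 1 := by positivity
  have h4 : Φ / u * (ℓ * (S / Φ)) ≤ ℓ / (r + 1) * S' := by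
    calc Φ / u * (ℓ * (S / Φ)) = ℓ / u * S := by field_simp
      _ ≤ ℓ / (r + 1) * S' := by gcongr
  -- The decrease Φ/u multiplies Φ by (u - 1)/u, which turns the denominator u - 1 back into u. The
  -- case of a zero numerator includes u = 1, where the denominator vanishes.
  have h5 : ((u - (r + 1) : ℕ) : ℝ) / (u - 1 : ℕ) * (Φ - (Φ - 2 * S') / u) ≤
      (u - (r + 1) : ℕ) * Φ / u + 2 / (r + 1) * S' := by
    have hS'0 : 0 ≤ S' := hS.trans hSS'
    rcases Nat.eq_zero_or_pos (u - (r + 1)) with h | h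
    · rw [h]
      simp only [Nat.cast_zero, zero_div, zero_mul, zero_add]
      positivity
    · have hv : (0 : ℝ) < (u - 1 : ℕ) := by exact_mod_cast (show 0 < u - 1 by omega)
      have hv' : ((u - 1 : ℕ) : ℝ) = u - 1 := by
        rw [Nat.cast_sub (by omega), Nat.cast_one]
      have hw : ((u - (r + 1) : ℕ) : ℝ) ≤ (u - 1 : ℕ) := by
        exact_mod_cast (show u - (r + 1) ≤ u - 1 by omega)
      calc ((u - (r + 1) : ℕ) : ℝ) / (u - 1 : ℕ) * (Φ - (Φ - 2 * S') / u)
          = (u - (r + 1) : ℕ) * Φ / u +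
              ((u - (r + 1) : ℕ) : ℝ) / (u - 1 : ℕ) * (2 / u * S') := by
            rw [hv'] at hv ⊢
            field_simp
            ring
        _ ≤ (u - (r + 1) : ℕ) * Φ / u + 1 * (2 / (r + 1) * S') := by
            gcongr
            rw [div_le_one hv]
            exact hw
        _ = _ := by ring
  have h6 : ((u - (r + 1) : ℕ) : ℝ) / (u - 1 : ℕ) * _ ≤ _ :=
    (mul_le_mul_of_nonneg_left h1 (by positivity)).trans h5
  have h7 := (mul_le_mul_of_nonneg_left h2 (show 0 ≤ Φ / u by positivity)).trans h4
  refine h3.trans ((add_le_add h6 h7).trans (le_of_eq ?_))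
  ring

lemma expect_coveredCost_le (hℓ : 1 ≤ ℓ) {k : ℕ} (hk : 1 ≤ k) (hsel : IsGreedy X sel)
    {i : ℕ} (hi : i ≤ k) :
    expect (seeding X sel (i + 1)) (coveredCost T a) ≤
      600000000 * ℓ ^ 2 * (4 + Real.log k) ^ 2 * clusteringCost T a := by
  unfold coveredCost clusteringCost
  rw [expect_sum, Finset.mul_sum]
  exact Finset.sum_le_sum fun t _ => expect_covered_costOn_le hℓ hk hsel _ t hi

/-- The first center always covers a cluster, leaving at most r for the r remaining steps. -/
lemma expect_seeding_one_missPotential {r : ℕ} (ha : ∀ x, a x ∈ T) (hr : T.card ≤ r + 1) :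
    expect (seeding X sel 1) (missPotential T a r) = 0 := by
  have h (c : X) : missPotential T a r (insert c ∅) = 0 := by
    refine missPotential_eq_zero ?_
    rw [uncovered_insert]
    have h1 : uncovered T a ∅ = T := by simp [uncovered]
    rw [h1, Finset.card_erase_of_mem (ha c)]
    omega
  change expect (addCenter sel (PMF.uniformOfFintype X) ∅) _ = _
  rw [expect_addCenter]
  simp only [h, expect_const]

/-- The approximation guarantee, relative to an arbitrary clustering. -/
lemma expect_costOn_le (ha : ∀ x, a x ∈ T) (hℓ : 1 ≤ ℓ) {n : ℕ} (hT : T.card ≤ n + 1)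
    (hsel : IsGreedy X sel) :
    expect (seeding X sel (n + 1)) (costOn Finset.univ) ≤
      ((ℓ + 2) * (600000000 * ℓ ^ 2 * (4 + Real.log (n + 1 : ℕ)) ^ 2 + 16) * harmonic n +
        600000000 * ℓ ^ 2 * (4 + Real.log (n + 1 : ℕ)) ^ 2) * clusteringCost T a := by
  set H : ℝ := 600000000 * ℓ ^ 2 * (4 + Real.log (n + 1 : ℕ)) ^ 2 with hH
  have hcov {i : ℕ} (hi : i ≤ n + 1) :
      expect (seeding X sel (i + 1)) (coveredCost T a) ≤ H * clusteringCost T a :=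
    expect_coveredCost_le hℓ (by omega) hsel hi
  -- After i + 1 centers r = n - i steps remain, so the increments 1/(r + 1) telescope to a
  -- difference of harmonic numbers.
  have hmiss (i : ℕ) : ∀ r, i + r = n →
      expect (seeding X sel (i + 1)) (missPotential T a r) ≤
        (ℓ + 2) * (H + 16) * ((harmonic n : ℝ) - harmonic r) * clusteringCost T a := by
    induction i with
    | zero =>
      intro r hr
      rw [zero_add] at hr ⊢
      rw [expect_seeding_one_missPotential ha (by omega), hr]
      simp
    | succ i ih =>
      intro r hr
      have h1 := ih (r + 1) (by omega)
      have h2 := expect_seeding_succ_le (fun C hC =>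
        expect_missPotential_le (T := T) ha hC hℓ hsel r) i
      rw [expect_const_mul, expect_add, expect_const] at h2
      have h3 : (ℓ + 2 : ℝ) / (r + 1) *
          (expect (seeding X sel (i + 1)) (coveredCost T a) + 16 * clusteringCost T a) ≤
          (ℓ + 2 : ℝ) / (r + 1) * ((H + 16) * clusteringCost T a) := by
        gcongr
        linarith [hcov (i := i) (by omega)]
      rw [harmonic_succ] at h1
      push_cast at h1
      refine h2.trans ((add_le_add h1 h3).trans (le_of_eq ?_))
      ring
  have h1 := hmiss n 0 (by omega)
  have h2 := hcov (i := n) (by omega)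
  have h3 : expect (seeding X sel (n + 1)) (costOn Finset.univ) ≤ _ :=
    expect_mono (costOn_le_missPotential_add (T := T) ha)
  rw [expect_add] at h3
  rw [harmonic_zero] at h1
  push_cast at h1
  linarith

end Clustering

/-! ### Comparison with arbitrary centers and the final constants -/

lemma expectedCost_le_cost {d k ℓ : ℕ} (hk : 2 ≤ k) (hℓ : 1 ≤ ℓ)
    (X : Finset (EuclideanSpace ℝ (Fin d))) [Nonempty X] (sel : Finset X → (Fin ℓ → X) → Fin ℓ)
    (hsel : IsGreedy X sel) {T : Finset (EuclideanSpace ℝ (Fin d))} (hT : T.Nonempty)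
    (hTk : T.card ≤ k) :
    expectedCost X sel k ≤ 1000000000000 * (ℓ : ℝ) ^ 3 * Real.log k ^ 3 * cost X T := by
  have hmin (x : X) := Finset.exists_mem_eq_inf' hT
    fun c => ‖(x : EuclideanSpace ℝ (Fin d)) - c‖ ^ 2
  -- Each data point goes to a nearest center of T. Clusters may be empty; these count as uncovered
  -- forever, which is harmless as only |T| ≤ k enters.
  choose a ha hax using hmin
  have hcost : clusteringCost T a = cost X T := by
    calc clusteringCost T a
        = ∑ t ∈ T, ∑ x ∈ cluster a t, ‖(x : EuclideanSpace ℝ (Fin d)) - a x‖ ^ 2 :=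
          Finset.sum_congr rfl fun t _ => Finset.sum_congr rfl fun x hx => by
            rw [mem_cluster.1 hx]
      _ = ∑ x : X, ‖(x : EuclideanSpace ℝ (Fin d)) - a x‖ ^ 2 := sum_cluster ha _
      _ = ∑ x : X, pointCost T x :=
          Finset.sum_congr rfl fun x _ => by rw [pointCost, dif_pos hT, hax]
      _ = cost X T := Finset.sum_coe_sort X fun x => pointCost T x
  have hexp : expectedCost X sel k = expect (seeding X sel k) (costOn Finset.univ) := by
    simp only [expectedCost, expect, cost_points]
  obtain ⟨n, rfl⟩ : ∃ n, k = n + 1 := ⟨k - 1, by omega⟩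
  have h := expect_costOn_le (T := T) ha hℓ hTk hsel
  rw [hexp, ← hcost]
  refine h.trans (mul_le_mul_of_nonneg_right ?_ clusteringCost_nonneg)
  have hn : (1 : ℝ) ≤ n := by exact_mod_cast (show 1 ≤ n by omega)
  have hharm : (harmonic n : ℝ) ≤ 1 + Real.log (n + 1 : ℕ) := by
    refine (harmonic_le_one_add_log n).trans ?_
    gcongr
    omega
  have hharm0 : (0 : ℝ) ≤ harmonic n := by
    rcases Nat.eq_zero_or_pos n with h0 | h0
    · simp [h0]
    · exact_mod_cast (harmonic_pos h0.ne').le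
  -- Any bound above 2/3 would do: it gives 4 + t ≤ 7t, and 1 + t ≤ 3t for the harmonic number.
  have hlog2 : 0.69 ≤ Real.log (n + 1 : ℕ) := by
    have h1 : Real.log 2 ≤ Real.log (n + 1 : ℕ) :=
      Real.log_le_log (by norm_num) (by exact_mod_cast hk)
    linarith [Real.log_two_gt_d9]
  set t := Real.log (n + 1 : ℕ) with ht
  have hℓ' : (1 : ℝ) ≤ ℓ := by exact_mod_cast hℓ
  have ht0 : 0 < t := by linarith
  have h1 : (4 + t) ^ 2 ≤ 49 * t ^ 2 := by nlinarith
  have h2 : (1 : ℝ) ≤ 3 * (ℓ ^ 2 * t ^ 2) := by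
    have : 1 ≤ 3 * t ^ 2 := by nlinarith
    have : (1 : ℝ) ≤ ℓ ^ 2 := by nlinarith
    nlinarith
  have h3 : 600000000 * ℓ ^ 2 * (4 + t) ^ 2 ≤ 29400000000 * (ℓ ^ 2 * t ^ 2) := by
    calc 600000000 * ℓ ^ 2 * (4 + t) ^ 2 ≤ 600000000 * ℓ ^ 2 * (49 * t ^ 2) := by gcongr
      _ = _ := by ring
  have h4 : (harmonic n : ℝ) ≤ 3 * t := by linarith
  have h5 : (ℓ : ℝ) ^ 2 * t ^ 2 ≤ 2 * (ℓ ^ 3 * t ^ 3) := by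
    have : (1 : ℝ) ≤ 2 * (ℓ * t) := by nlinarith
    calc (ℓ : ℝ) ^ 2 * t ^ 2 = ℓ ^ 2 * t ^ 2 * 1 := by ring
      _ ≤ ℓ ^ 2 * t ^ 2 * (2 * (ℓ * t)) := by gcongr
      _ = _ := by ring
  have h6 : (ℓ + 2) * (600000000 * ℓ ^ 2 * (4 + t) ^ 2 + 16) * (harmonic n : ℝ) ≤
      (3 * ℓ) * (29400000048 * (ℓ ^ 2 * t ^ 2)) * (3 * t) := by
    gcongr
    · linarith
    · linarith
  have h7 : (3 * ℓ) * (29400000048 * (ℓ ^ 2 * t ^ 2)) * (3 * t) =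
      264600000432 * (ℓ ^ 3 * t ^ 3) := by ring
  have h8 : (0 : ℝ) ≤ ℓ ^ 3 * t ^ 3 := by positivity
  linarith

end

end GreedyKMeans

theorem mainTheorem1 :
    ∃ A : ℝ, 0 < A ∧
      ∀ (d k ℓ : ℕ), 2 ≤ k → 1 ≤ ℓ →
        ∀ (X : Finset (EuclideanSpace ℝ (Fin d))) [Nonempty X]
          (sel : Finset X → (Fin ℓ → X) → Fin ℓ), GreedyKMeans.IsGreedy X sel →
          GreedyKMeans.expectedCost X sel k ≤
            A * (ℓ : ℝ) ^ 3 * Real.log k ^ 3 * GreedyKMeans.optCost X k := by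
  refine ⟨1000000000000, by norm_num, fun d k ℓ hk hℓ X _ sel hsel => ?_⟩
  have hlog : 0 < Real.log k := Real.log_pos (by exact_mod_cast hk)
  have hℓ' : (0 : ℝ) < ℓ := by exact_mod_cast hℓ
  have hpos : 0 < 1000000000000 * (ℓ : ℝ) ^ 3 * Real.log k ^ 3 := by positivity
  rw [mul_comm, ← div_le_iff₀ hpos]
  -- The infimum need not be known to be attained: the bound holds against every admissible T, and
  -- the center set {0} shows that some T is admissible.
  refine le_csInf ⟨_, {0}, ⟨Finset.singleton_nonempty _, ?_⟩, rfl⟩ ?_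
  · rw [Finset.card_singleton]
    omega
  · rintro _ ⟨T, ⟨hT, hTk⟩, rfl⟩
    rw [div_le_iff₀ hpos, mul_comm]
    exact GreedyKMeans.expectedCost_le_cost hk hℓ X sel hsel hT hTk
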